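/- Let $N\ge 2$ and let $\mathbb{R}^{N\times N}_{0,\mathrm{sym}}$ be the space of real symmetric traceless $N\times N$ matrices. For $e\in\mathbb{R}$ put $$\mathcal{S}[e]=\Big\{[\mathbf{w},\mathbb{H}]\in\mathbb{R}^N\times\mathbb{R}^{N\times N}_{0,\mathrm{sym}}\ \Big|\ \tfrac N2\,\lambda_{\max}[\mathbf{w}\otimes\mathbf{w}-\mathbb{H}]<e\Big\},$$ where $\lambda_{\max}$ denotes the maximal eigenvalue, and let $Q=(0,1)\times(0,1)^N$. A map $G$ from $\Omega$ to a topological space $X$ is said to have compact range in $X$ if it is Borel measurable and there is a deterministic compact set $\mathcal{K}\subset X$ with $G\in\mathcal{K}$ almost surely. There is a constant $c(N)>0$, depending only on $N$, such that the following holds. Let $(\Omega,\mathfrak{F},\mathbb{P})$ be a complete probability space and let $\omega\mapsto[e,\mathbf{w},\mathbb{H}](\omega)\in(0,\infty)\times\mathbb{R}^N\times\mathbb{R}^{N\times N}_{0,\mathrm{sym}}$ be Borel measurable with $[\mathbf{w},\mathbb{H}]\in\mathcal{S}[e]$ $\mathbb{P}$-a.s. Then there are sequences of random fields $\mathbf{w}_n$,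 $\mathbb{V}_n$, $n\in\mathbb{N}$, with $\mathbf{w}_n\in C_c^\infty(Q;\mathbb{R}^N)$ and $\mathbb{V}_n\in C_c^\infty(Q;\mathbb{R}^{N\times N}_{0,\mathrm{sym}})$ $\mathbb{P}$-a.s., such that: 1. for all $n$ and all $t\in[0,1]$, the map $\omega\mapsto[\mathbf{w}_n(t,\cdot),\mathbb{V}_n(t,\cdot)]\in C([0,1]^N;\mathbb{R}^N\times\mathbb{R}^{N\times N}_{0,\mathrm{sym}})$ is Borel measurable; 2. for all $n$, $\mathbb{P}$-a.s., $\partial_t\mathbf{w}_n+\mathrm{div}_x\mathbb{V}_n=0$ and $\mathrm{div}_x\mathbf{w}_n=0$ in $Q$; 3. $\mathbb{P}$-a.s., $\mathbf{w}_n\to0$ in $C_{\mathrm{weak}}([0,1];L^2([0,1]^N;\mathbb{R}^N))$, that is, for every $\mathbf{g}\in L^2([0,1]^N;\mathbb{R}^N)$, $\int_{[0,1]^N}\mathbf{w}_n(t,x)\cdot\mathbf{g}(x)\,dx\to0$ uniformly in $t\in[0,1]$; 4. for all $n$, $\mathbb{P}$-a.s., $[\mathbf{w}+\mathbf{w}_n(t,x),\mathbb{H}+\mathbb{V}_n(t,x)]\in\mathcal{S}[e]$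 for all $(t,x)\in Q$; 5. $\mathbb{P}$-a.s., $$\liminf_{n\to\infty}\frac1{|Q|}\int_Q|\mathbf{w}_n|^2\,dx\,dt\ \ge\ \frac{c(N)}{e}\Big(e-\tfrac12|\mathbf{w}|^2\Big)^2 .$$ If, in addition, $e\le\overline{e}$ $\mathbb{P}$-a.s. for some deterministic constant $\overline{e}$ and $[\mathbf{w},\mathbb{H}]\in\mathcal{S}[e-\delta]$ $\mathbb{P}$-a.s. for some deterministic constant $\delta>0$, then the fields can be chosen such that, besides 1–5, for each $n$ the maps $\mathbf{w}_n$ and $\mathbb{V}_n$ have compact range in $C(\overline{Q};\mathbb{R}^N)$ and $C(\overline{Q};\mathbb{R}^{N\times N}_{0,\mathrm{sym}})$, respectively, and there are deterministic constants $\delta_n>0$ such that, for all $n$, $\mathbb{P}$-a.s., $[\mathbf{w}+\mathbf{w}_n(t,x),\mathbb{H}+\mathbb{V}_n(t,x)]\in\mathcal{S}[e-\delta_n]$ for all $(t,x)\in Q$. -/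

import Mathlib

open Set Filter Topology MeasureTheory
open scoped RealInnerProductSpace

namespace OscillatoryLemma

noncomputable section

/-- Euclidean space `ℝ^N`. -/
abbrev Vec (N : ℕ) : Type := EuclideanSpace ℝ (Fin N)

/-- Space-time `ℝ × ℝ^N`, with points `(t, x)`. -/
abbrev SpaceTime (N : ℕ) : Type := ℝ × Vec N

/-- The space of real symmetric traceless `N × N` matrices. -/
def Sym0 (N : ℕ) : Submodule ℝ (Matrix (Fin N) (Fin N) ℝ) where
  carrier := {A | A.IsSymm ∧ A.trace = 0}
  add_mem' := fun ha hb => ⟨ha.1.add hb.1, by rw [Matrix.trace_add, ha.2, hb.2, add_zero]⟩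
  zero_mem' := ⟨Matrix.isSymm_zero, Matrix.trace_zero _ _⟩
  smul_mem' := fun c _ ha => ⟨ha.1.smul c, by rw [Matrix.trace_smul, ha.2, smul_zero]⟩

/-- The maximal eigenvalue of a real symmetric matrix (of positive size). -/
def lambdaMax {N : ℕ} (A : Matrix (Fin N) (Fin N) ℝ) : ℝ := sSup (spectrum ℝ A)

/-- The set `S[e]` of all `[w, H]` with `(N / 2) λ_max [w ⊗ w - H] < e`. -/
def S (N : ℕ) (e : ℝ) : Set (Vec N × Sym0 N) :=
  {p | (N : ℝ) / 2 *
    lambdaMax (Matrix.vecMulVec (fun i => p.1 i) (fun i => p.1 i) -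
      (p.2 : Matrix (Fin N) (Fin N) ℝ)) < e}

/-- The open unit space-time cube `(0,1) × (0,1)^N`. -/
def Q (N : ℕ) : Set (SpaceTime N) :=
  {p | p.1 ∈ Ioo (0 : ℝ) 1 ∧ ∀ i, p.2 i ∈ Ioo (0 : ℝ) 1}

/-- The closed spatial unit cube `[0,1]^N`. -/
def cube (N : ℕ) : Set (Vec N) := {x | ∀ i, x i ∈ Icc (0 : ℝ) 1}

/-- The time derivative of a scalar function on space-time. -/
def dt {N : ℕ} (f : SpaceTime N → ℝ) (p : SpaceTime N) : ℝ :=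
  fderiv ℝ f p ((1 : ℝ), (0 : Vec N))

/-- The `j`-th spatial partial derivative of a scalar function on space-time. -/
def dx {N : ℕ} (j : Fin N) (f : SpaceTime N → ℝ) (p : SpaceTime N) : ℝ :=
  fderiv ℝ f p ((0 : ℝ), EuclideanSpace.single j (1 : ℝ))

/-- `w ∈ C_c^∞(Q; ℝ^N)`, for a function extended by zero to all of space-time. -/
def IsTestVec {N : ℕ} (w : SpaceTime N → Vec N) : Prop :=
  ContDiff ℝ (⊤ : ℕ∞) w ∧ HasCompactSupport w ∧ tsupport w ⊆ Q N

/-- `V ∈ C_c^∞(Q; Sym0 N)`, for a function extended by zero to all of space-time;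
smoothness of the matrix field is smoothness of its entries. -/
def IsTestMat {N : ℕ} (V : SpaceTime N → Sym0 N) : Prop :=
  (∀ i j, ContDiff ℝ (⊤ : ℕ∞) fun p => (V p : Matrix (Fin N) (Fin N) ℝ) i j) ∧
    HasCompactSupport V ∧ tsupport V ⊆ Q N

/-- The system `∂_t w + div_x V = 0`, `div_x w = 0` in `Q`. -/
def SolvesLinear {N : ℕ} (w : SpaceTime N → Vec N) (V : SpaceTime N → Sym0 N) : Prop :=
  ∀ p ∈ Q N,
    (∀ i, dt (fun q => w q i) p +
      ∑ j, dx j (fun q => (V q : Matrix (Fin N) (Fin N) ℝ) i j) p = 0) ∧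
    ∑ j, dx j (fun q => w q j) p = 0

/-- The embedding `x ↦ (t, x)` of the spatial cube into space-time. -/
def atTime (N : ℕ) (t : ℝ) : C(cube N, SpaceTime N) where
  toFun x := (t, (x : Vec N))
  continuous_toFun := by fun_prop

/-- The time slice `[w(t, ·), V(t, ·)]` as an element of `C([0,1]^N; ℝ^N × Sym0 N)`. -/
def slice {N : ℕ} (t : ℝ) (w : C(SpaceTime N, Vec N)) (V : C(SpaceTime N, Sym0 N)) :
    C(cube N, Vec N × Sym0 N) :=
  (w.comp (atTime N t)).prodMk (V.comp (atTime N t))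

/-- `w_n → 0` in `C_weak([0,1]; L²([0,1]^N; ℝ^N))`: for every `g ∈ L²`, the pairing
`∫ w_n(t, x) · g(x) dx` tends to `0` uniformly in `t ∈ [0,1]`. -/
def TendstoZeroCWeak {N : ℕ} (w : ℕ → SpaceTime N → Vec N) : Prop :=
  ∀ g : Vec N → Vec N, MemLp g 2 (volume.restrict (cube N)) →
    TendstoUniformlyOn (fun (n : ℕ) (t : ℝ) => ∫ x in cube N, ⟪w n (t, x), g x⟫)
      (fun _ => 0) atTop (Icc (0 : ℝ) 1)

/-- A map into a topological space that is measurable with respect to the Borel sets. -/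
def BorelMeasurable {Ω X : Type*} [MeasurableSpace Ω] [TopologicalSpace X] (G : Ω → X) : Prop :=
  @Measurable Ω X _ (borel X) G

/-- A Borel random variable has compact range if it almost surely takes its values in a
deterministic compact set. -/
def HasCompactRange {Ω X : Type*} [MeasurableSpace Ω] [TopologicalSpace X] (μ : Measure Ω)
    (G : Ω → X) : Prop :=
  BorelMeasurable G ∧ ∃ K : Set X, IsCompact K ∧ ∀ᵐ ω ∂μ, G ω ∈ K

end

end OscillatoryLemma

open Set Filter Topology MeasureTheory
open scoped RealInnerProductSpace

namespace OscillatoryLemma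

noncomputable section

/-! Membership of `[w, H]` in `S N e` means that the quadratic form of `w ⊗ w - H` (`stressForm`) is
bounded by `2e'/N` for some `e' < e`. Fix the data and let `v` be a unit eigenvector for the
smallest eigenvalue. Moving by `a` along `(v, w ⊗ v + v ⊗ w - 2⟨w,v⟩ v ⊗ v)` only adds `(a² +
2a⟨w,v⟩) v ⊗ v` to the matrix, so only this eigenvalue moves. Since the trace is `|w|²`, it is at
most `|w|²/N`, which leaves room for `|a| ≤ (e - |w|²/2)/(4N√e)`; this is `exists_direction`.

This direction carries exact plane waves: for a unit `k ⟂ v`, a profile in `k·(x - tw)` is constant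
along `v` and along the transport by `w`. A cutoff destroys the equations, and the potentials
`pot₁`, ..., `pot₄` restore them. They are homogeneous fourth-order operators producing exact
solutions supported where the cutoff is. Only `pot₁` contains a fourth derivative along `k`, so
after division by `n⁴` all other terms are `O(1/n)` (`exists_potentials`). Riemann–Lebesgue then
gives weak convergence, uniform in time, and the limit of the energy, which is proportional to the
squared amplitude. This settles constant data (`exists_oscillation`).

Randomness is handled by openness. All inequalities are strict, so one sequence serves a whole
neighbourhood of parameters (`exists_local_oscillation`). By Lindelöf countably many sequences
suffice, and the first admissible index is a measurable function of `ω`. The fields factor through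
this index, so their measurability is automatic. If `e` is bounded and there is a margin `δ`, the
parameters stay in a compact set (`isCompact_parameters`). The indices are then almost surely
bounded, and the same fields have finite range and a common margin. -/

open Matrix in
/-- The quadratic form of the matrix `w ⊗ w - H`. -/
def stressForm {N : ℕ} (w : Vec N) (H : Matrix (Fin N) (Fin N) ℝ) (ξ : Vec N) : ℝ :=
  ⟪w, ξ⟫ ^ 2 - ξ.ofLp ⬝ᵥ H *ᵥ ξ.ofLp

/-! ### Spectral geometry of `w ⊗ w - H` and the admissible direction -/

section LinearAlgebra

open Matrix

variable {N : ℕ}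

lemma inner_eq_dotProduct (x y : Vec N) : ⟪x, y⟫ = x.ofLp ⬝ᵥ y.ofLp := by
  rw [EuclideanSpace.inner_eq_star_dotProduct, star_trivial, dotProduct_comm]

lemma dotProduct_mulVec_comm {A : Matrix (Fin N) (Fin N) ℝ} (hA : A.IsSymm) (x y : Fin N → ℝ) :
    x ⬝ᵥ A *ᵥ y = y ⬝ᵥ A *ᵥ x := by
  rw [dotProduct_mulVec, ← mulVec_transpose, hA.eq, dotProduct_comm]

/-- The maximal eigenvalue of a symmetric matrix is attained and bounds the quadratic form. -/
lemma exists_top_eigenvector (hN : 0 < N) {A : Matrix (Fin N) (Fin N) ℝ} (hA : A.IsSymm) :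
    ∃ v : Vec N, ‖v‖ = 1 ∧ A *ᵥ v.ofLp = lambdaMax A • v.ofLp ∧
      ∀ ξ : Vec N, ξ.ofLp ⬝ᵥ A *ᵥ ξ.ofLp ≤ lambdaMax A * ‖ξ‖ ^ 2 := by
  have hH : A.IsHermitian := by
    rw [IsHermitian, conjTranspose_eq_transpose_of_trivial]; exact hA
  have : Nonempty (Fin N) := ⟨⟨0, hN⟩⟩
  obtain ⟨i, hi⟩ := Finite.exists_max hH.eigenvalues
  have hl : lambdaMax A = hH.eigenvalues i := by
    rw [lambdaMax, hH.spectrum_real_eq_range_eigenvalues]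
    exact IsGreatest.csSup_eq ⟨mem_range_self i, by rintro _ ⟨j, rfl⟩; exact hi j⟩
  refine ⟨hH.eigenvectorBasis i, hH.eigenvectorBasis.orthonormal.1 i, ?_, fun ξ => ?_⟩
  · rw [hl]; exact hH.mulVec_eigenvectorBasis i
  · have hps : (lambdaMax A • (1 : Matrix (Fin N) (Fin N) ℝ) - A).PosSemidef := by
      rw [posSemidef_iff_isHermitian_and_spectrum_nonneg]
      refine ⟨(isHermitian_one.smul (IsSelfAdjoint.all _)).sub hH, ?_⟩
      rw [← Algebra.algebraMap_eq_smul_one, ← spectrum.singleton_sub_eq,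
        hH.spectrum_real_eq_range_eigenvalues]
      rintro _ ⟨a, rfl, _, ⟨j, rfl⟩, rfl⟩
      simpa [hl] using hi j
    have := hps.dotProduct_mulVec_nonneg ξ.ofLp
    rw [star_trivial, sub_mulVec, dotProduct_sub, smul_mulVec, one_mulVec, dotProduct_smul,
      ← inner_eq_dotProduct, real_inner_self_eq_norm_sq, smul_eq_mul] at this
    linarith

lemma dotProduct_vecMulVec (w ξ η : Vec N) :
    ξ.ofLp ⬝ᵥ vecMulVec w.ofLp w.ofLp *ᵥ η.ofLp = ⟪w, ξ⟫ * ⟪w, η⟫ := by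
  rw [vecMulVec_mulVec, inner_eq_dotProduct, inner_eq_dotProduct, dotProduct_comm w.ofLp ξ.ofLp]
  simp [dotProduct_smul, mul_comm]

lemma stressForm_eq (w : Vec N) (H : Matrix (Fin N) (Fin N) ℝ) (ξ : Vec N) :
    stressForm w H ξ = ξ.ofLp ⬝ᵥ (vecMulVec w.ofLp w.ofLp - H) *ᵥ ξ.ofLp := by
  rw [sub_mulVec, dotProduct_sub, dotProduct_vecMulVec, stressForm, sq]

lemma isSymm_vecMulVec_sub (w : Vec N) (H : Sym0 N) :
    (vecMulVec w.ofLp w.ofLp - (H : Matrix (Fin N) (Fin N) ℝ)).IsSymm :=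
  IsSymm.sub (IsSymm.ext fun i j => by simp [vecMulVec_apply, mul_comm]) H.2.1

lemma mem_S_of_stressForm_le (hN : 0 < N) {e e' : ℝ} (h : e' < e) {w : Vec N} {H : Sym0 N}
    (hq : ∀ ξ, stressForm w (H : Matrix (Fin N) (Fin N) ℝ) ξ ≤ 2 * e' / N * ‖ξ‖ ^ 2) :
    (w, H) ∈ S N e := by
  obtain ⟨v, hv, hev, -⟩ := exists_top_eigenvector hN (isSymm_vecMulVec_sub w H)
  have := hq v
  rw [stressForm_eq, hev, dotProduct_smul, ← inner_eq_dotProduct, real_inner_self_eq_norm_sq, hv]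
    at this
  have hN' : (0 : ℝ) < N := by exact_mod_cast hN
  have h2 : (N : ℝ) / 2 * (2 * e' / N) = e' := by field_simp
  refine lt_of_le_of_lt ?_ h
  rw [← h2]
  exact mul_le_mul_of_nonneg_left (by simpa using this) (by positivity)

lemma exists_stressForm_le_of_mem_S (hN : 0 < N) {e : ℝ} {w : Vec N} {H : Sym0 N}
    (h : (w, H) ∈ S N e) :
    ∃ e' < e, ∀ ξ, stressForm w (H : Matrix (Fin N) (Fin N) ℝ) ξ ≤ 2 * e' / N * ‖ξ‖ ^ 2 := by
  obtain ⟨v, hv, hev, hle⟩ := exists_top_eigenvector hN (isSymm_vecMulVec_sub w H)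
  -- The witness `e'` is `N / 2` times the maximal eigenvalue, read off from `h`.
  refine ⟨_, h, fun ξ => ?_⟩
  have hN' : (0 : ℝ) < N := by exact_mod_cast hN
  rw [stressForm_eq]
  refine (hle ξ).trans (le_of_eq ?_)
  congr 1
  field_simp

lemma stressForm_single (w : Vec N) (H : Matrix (Fin N) (Fin N) ℝ) (i : Fin N) :
    stressForm w H (EuclideanSpace.single i 1) = w i ^ 2 - H i i := by
  rw [stressForm, EuclideanSpace.inner_single_right]
  simp

/-- `H` drops out because it is traceless. This trace identity is behind the bound on `w` and the
bound on the bottom eigenvalue. -/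
lemma sum_stressForm_single (w : Vec N) (H : Sym0 N) :
    ∑ i, stressForm w (H : Matrix (Fin N) (Fin N) ℝ) (EuclideanSpace.single i 1) = ‖w‖ ^ 2 := by
  simp_rw [stressForm_single, Finset.sum_sub_distrib]
  have : ∑ i, (H : Matrix (Fin N) (Fin N) ℝ) i i = 0 := H.2.2
  rw [this, EuclideanSpace.real_norm_sq_eq, sub_zero]

lemma norm_sq_le_of_stressForm_le (hN : 0 < N) {e : ℝ} {w : Vec N} {H : Sym0 N}
    (hq : ∀ ξ, stressForm w (H : Matrix (Fin N) (Fin N) ℝ) ξ ≤ 2 * e / N * ‖ξ‖ ^ 2) :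
    ‖w‖ ^ 2 ≤ 2 * e := by
  rw [← sum_stressForm_single w H]
  refine (Finset.sum_le_sum fun i _ => hq _).trans (le_of_eq ?_)
  have hN' : (0 : ℝ) < N := by exact_mod_cast hN
  simp
  field_simp

/-- The bottom eigenvector of `w ⊗ w - H`. -/
lemma exists_bottom_eigenvector (hN : 0 < N) (w : Vec N) (H : Sym0 N) :
    ∃ (v : Vec N) (μ : ℝ), ‖v‖ = 1 ∧ N * μ ≤ ‖w‖ ^ 2 ∧
      (vecMulVec w.ofLp w.ofLp - (H : Matrix (Fin N) (Fin N) ℝ)) *ᵥ v.ofLp = μ • v.ofLp := by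
  obtain ⟨v, hv, hev, hle⟩ := exists_top_eigenvector hN (isSymm_vecMulVec_sub w H).neg
  refine ⟨v, -lambdaMax (-(vecMulVec w.ofLp w.ofLp - (H : Matrix (Fin N) (Fin N) ℝ))), hv, ?_, ?_⟩
  · rw [← sum_stressForm_single w H]
    refine le_trans (le_of_eq ?_) (Finset.sum_le_sum (f := fun _ : Fin N =>
      -lambdaMax (-(vecMulVec w.ofLp w.ofLp - (H : Matrix (Fin N) (Fin N) ℝ)))) fun i _ => ?_)
    · simp
    · have := hle (EuclideanSpace.single i 1)
      rw [stressForm_eq]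
      rw [neg_mulVec, dotProduct_neg] at this
      simp only [PiLp.norm_single, norm_one, one_pow, mul_one] at this
      linarith
  · rw [neg_mulVec] at hev
    rw [neg_smul, ← hev, neg_neg]

lemma dotProduct_mulVec_le (G : Matrix (Fin N) (Fin N) ℝ) (ξ : Vec N) :
    |ξ.ofLp ⬝ᵥ G *ᵥ ξ.ofLp| ≤ (∑ i, ∑ j, |G i j|) * ‖ξ‖ ^ 2 := by
  simp_rw [dotProduct, mulVec, dotProduct, Finset.mul_sum, Finset.sum_mul]
  refine (Finset.abs_sum_le_sum_abs _ _).trans (Finset.sum_le_sum fun i _ => ?_)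
  refine (Finset.abs_sum_le_sum_abs _ _).trans (Finset.sum_le_sum fun j _ => ?_)
  rw [abs_mul, abs_mul]
  have h1 : |ξ.ofLp i| ≤ ‖ξ‖ := PiLp.norm_apply_le ξ i
  have h2 : |ξ.ofLp j| ≤ ‖ξ‖ := PiLp.norm_apply_le ξ j
  calc |ξ.ofLp i| * (|G i j| * |ξ.ofLp j|) ≤ ‖ξ‖ * (|G i j| * ‖ξ‖) := by gcongr
    _ = _ := by ring

/-- Stability of the quadratic form under perturbations. -/
lemma stressForm_add_le (w a : Vec N) (H G : Matrix (Fin N) (Fin N) ℝ) (ξ : Vec N) :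
    stressForm (w + a) (H + G) ξ ≤ stressForm w H ξ +
      (‖a‖ * (‖a‖ + 2 * ‖w‖) + ∑ i, ∑ j, |G i j|) * ‖ξ‖ ^ 2 := by
  have h1 := neg_le_of_abs_le (dotProduct_mulVec_le G ξ)
  have h2 : ⟪a, ξ⟫ * ⟪a + (2 : ℝ) • w, ξ⟫ ≤ ‖a‖ * (‖a‖ + 2 * ‖w‖) * ‖ξ‖ ^ 2 := by
    refine (le_abs_self _).trans ?_
    rw [abs_mul]
    calc |⟪a, ξ⟫| * |⟪a + (2 : ℝ) • w, ξ⟫| ≤ (‖a‖ * ‖ξ‖) * (‖a + (2 : ℝ) • w‖ * ‖ξ‖) := by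
          gcongr <;> exact abs_real_inner_le_norm _ _
      _ ≤ (‖a‖ * ‖ξ‖) * ((‖a‖ + 2 * ‖w‖) * ‖ξ‖) := by
          gcongr
          refine (norm_add_le _ _).trans (le_of_eq ?_)
          rw [norm_smul]; simp
      _ = _ := by ring
  have h3 : stressForm (w + a) (H + G) ξ = stressForm w H ξ + ⟪a, ξ⟫ * ⟪a + (2 : ℝ) • w, ξ⟫
      - ξ.ofLp ⬝ᵥ G *ᵥ ξ.ofLp := by
    simp only [stressForm, inner_add_left, inner_smul_left, add_mulVec, dotProduct_add]
    simp
    ring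
  rw [h3, add_mul]
  linarith

/-- The traceless symmetric matrix accompanying the velocity direction `v` in a shear flow
transported by `w`. -/
def shearStress (w v : Vec N) : Matrix (Fin N) (Fin N) ℝ :=
  fun i j => w i * v j + v i * w j - 2 * ⟪w, v⟫ * (v i * v j)

lemma dotProduct_shearStress (w v ξ : Vec N) :
    ξ.ofLp ⬝ᵥ shearStress w v *ᵥ ξ.ofLp = 2 * ⟪w, ξ⟫ * ⟪v, ξ⟫ - 2 * ⟪w, v⟫ * ⟪v, ξ⟫ ^ 2 := by
  have : shearStress w v = vecMulVec w.ofLp v.ofLp + vecMulVec v.ofLp w.ofLp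
      - (2 * ⟪w, v⟫) • vecMulVec v.ofLp v.ofLp := by
    ext i j; simp [shearStress, vecMulVec_apply]
  rw [this, sub_mulVec, add_mulVec, smul_mulVec, dotProduct_sub, dotProduct_add, dotProduct_smul,
    dotProduct_vecMulVec]
  simp only [vecMulVec_mulVec, inner_eq_dotProduct, dotProduct_comm ξ.ofLp, smul_eq_mul]
  simp [smul_dotProduct]
  ring

lemma exists_orthogonal_unit (hN : 2 ≤ N) (v : Vec N) : ∃ k : Vec N, ‖k‖ = 1 ∧ ⟪v, k⟫ = 0 := by
  have hlt : (ℝ ∙ v) < ⊤ := by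
    refine lt_top_iff_ne_top.2 fun h => ?_
    have h1 := finrank_span_le_card (R := ℝ) ({v} : Set (Vec N))
    rw [h, finrank_top, finrank_euclideanSpace_fin] at h1
    simp at h1
    omega
  obtain ⟨x, hx, hx0⟩ := Submodule.exists_mem_ne_zero_of_ne_bot
    (mt (Submodule.orthogonal_eq_bot_iff (K := ℝ ∙ v)).1 hlt.ne)
  refine ⟨(‖x‖⁻¹ : ℝ) • x, norm_smul_inv_norm hx0, ?_⟩
  rw [inner_smul_right, Submodule.mem_orthogonal_singleton_iff_inner_right.1 hx, mul_zero]

/-- For every point of `S N e` there is a long segment through it, contained in `S N e`, in a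
direction of a plane wave solution. -/
lemma exists_direction (hN : 2 ≤ N) {e : ℝ} (he : 0 < e) {w : Vec N} {H : Sym0 N}
    (h : (w, H) ∈ S N e) :
    ∃ v k : Vec N, ‖v‖ = 1 ∧ ‖k‖ = 1 ∧ ⟪v, k⟫ = 0 ∧ ∃ e' < e, ∀ s : ℝ, |s| ≤ 1 → ∀ ξ,
      let r := (e - ‖w‖ ^ 2 / 2) / (4 * N * √e)
      stressForm (w + (s * r) • v) ((H : Matrix (Fin N) (Fin N) ℝ) + (s * r) • shearStress w v) ξ
        ≤ 2 * e' / N * ‖ξ‖ ^ 2 := by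
  have hN0 : 0 < N := by omega
  have hN' : (2 : ℝ) ≤ N := by exact_mod_cast hN
  obtain ⟨e₁, he₁, hq⟩ := exists_stressForm_le_of_mem_S hN0 h
  obtain ⟨v, μ, hv, hμ, hev⟩ := exists_bottom_eigenvector hN0 w H
  obtain ⟨k, hk, hvk⟩ := exists_orthogonal_unit hN v
  have hw := norm_sq_le_of_stressForm_le hN0 hq
  set D := e - ‖w‖ ^ 2 / 2 with hD
  have hD0 : 0 < D := by linarith
  -- Orthogonally to `v` the old bound `e₁` persists. Along `v` half of the room is spent: `N μ + D
  -- ≤ ‖w‖ ^ 2 + D = 2 (e - D / 2)`.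
  refine ⟨v, k, hv, hk, hvk, max e₁ (e - D / 2), max_lt he₁ (by linarith), fun s hs ξ => ?_⟩
  intro r
  have hse : 0 < √e := Real.sqrt_pos.2 he
  have hr0 : 0 ≤ r := by positivity
  have hr : r * (4 * N * √e) = D := div_mul_cancel₀ _ (by positivity)
  have hee : √e ^ 2 = e := Real.sq_sqrt he.le
  -- From `‖w‖ ^ 2 ≤ 2 e` and `√2 ≤ 3 / 2`; the rational constant makes the count in `hbound` exact.
  have hwe : ‖w‖ ≤ 3 / 2 * √e := by
    refine le_of_sq_le_sq ?_ (by positivity)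
    rw [mul_pow, hee]; linarith
  set x := ⟪v, ξ⟫ with hx
  set η := ξ - x • v with hη
  have hvη : ⟪v, η⟫ = 0 := by
    rw [hη, inner_sub_right, inner_smul_right, real_inner_self_eq_norm_sq, hv, ← hx]; ring
  have hξ : ξ = η + x • v := by simp [hη]
  have hnorm : ‖ξ‖ ^ 2 = ‖η‖ ^ 2 + x ^ 2 := by
    rw [hξ, norm_add_sq_real, inner_smul_right, real_inner_comm, hvη, norm_smul, hv]
    simp
  -- No cross term appears, since `v` is an eigenvector and `η ⟂ v`.
  have hform : stressForm w H ξ = stressForm w H η + μ * x ^ 2 := by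
    rw [stressForm_eq, stressForm_eq, hξ]
    simp only [WithLp.ofLp_add, WithLp.ofLp_smul, mulVec_add, mulVec_smul, hev, add_dotProduct,
      dotProduct_add, smul_dotProduct, dotProduct_smul]
    rw [dotProduct_mulVec_comm (isSymm_vecMulVec_sub w H) v.ofLp η.ofLp, hev]
    simp only [dotProduct_smul, ← inner_eq_dotProduct, real_inner_self_eq_norm_sq, hv,
      real_inner_comm v η, hvη, smul_eq_mul]
    ring
  -- `shearStress` is designed to cancel the mixed term `⟪w, ξ⟫ * ⟪v, ξ⟫`, so only a multiple of `v
  -- ⊗ v` survives.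
  have hpert : stressForm (w + (s * r) • v)
      ((H : Matrix (Fin N) (Fin N) ℝ) + (s * r) • shearStress w v) ξ =
      stressForm w H ξ + (2 * (s * r) * ⟪w, v⟫ + (s * r) ^ 2) * x ^ 2 := by
    simp only [stressForm, inner_add_left, inner_smul_left, add_mulVec, dotProduct_add,
      smul_mulVec, dotProduct_smul, dotProduct_shearStress, ← hx]
    simp
    ring
  have hsr : |s * r| ≤ r := by
    rw [abs_mul, abs_of_nonneg hr0]; exact mul_le_of_le_one_left hr0 hs
  have hwv : |⟪w, v⟫| ≤ 3 / 2 * √e := by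
    have := abs_real_inner_le_norm w v
    rw [hv, mul_one] at this
    exact this.trans hwe
  -- This fixes the denominator of `r`: with `r ≤ √e` the left side is at most `N (2 · 3/2 + 1) r √e
  -- = 4 N r √e = D`.
  have hbound : N * (2 * (s * r) * ⟪w, v⟫ + (s * r) ^ 2) ≤ D := by
    have h1 : s * r * ⟪w, v⟫ ≤ r * (3 / 2 * √e) := by
      refine (le_abs_self _).trans ?_
      rw [abs_mul]; gcongr
    have h2 : (s * r) ^ 2 ≤ r ^ 2 := sq_le_sq.2 (by rwa [abs_of_nonneg hr0])
    have hDe : D ≤ √e ^ 2 := by rw [hee]; nlinarith [sq_nonneg ‖w‖]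
    have h3 : r ≤ √e := by
      by_contra hcon
      push Not at hcon
      have : √e * (4 * N * √e) < D := by rw [← hr]; gcongr
      nlinarith [mul_pos hse hse]
    calc N * (2 * (s * r) * ⟪w, v⟫ + (s * r) ^ 2)
        ≤ N * (2 * (r * (3 / 2 * √e)) + r * √e) := by
          refine mul_le_mul_of_nonneg_left (add_le_add (by linarith) (h2.trans ?_)) (by linarith)
          rw [sq]; gcongr
      _ = D := by rw [← hr]; ring
  rw [hpert, hform, hnorm]
  have hmax1 : 2 * e₁ / N ≤ 2 * max e₁ (e - D / 2) / N := by gcongr; exact le_max_left _ _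
  have hmax2 : μ + (2 * (s * r) * ⟪w, v⟫ + (s * r) ^ 2) ≤ 2 * max e₁ (e - D / 2) / N := by
    rw [le_div_iff₀ (by linarith)]
    have := le_max_right e₁ (e - D / 2)
    linarith
  calc _ = stressForm w H η + (μ + (2 * (s * r) * ⟪w, v⟫ + (s * r) ^ 2)) * x ^ 2 := by ring
    _ ≤ 2 * e₁ / N * ‖η‖ ^ 2 + 2 * max e₁ (e - D / 2) / N * x ^ 2 := by
        gcongr; exact hq η
    _ ≤ 2 * max e₁ (e - D / 2) / N * ‖η‖ ^ 2 + 2 * max e₁ (e - D / 2) / N * x ^ 2 := by gcongr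
    _ = _ := by ring

end LinearAlgebra

/-! ### Commuting directional derivatives on smooth functions -/

section Smooth

variable {E : Type*} [NormedAddCommGroup E] [NormedSpace ℝ E]

variable (E) in
/-- The algebra of smooth real functions on `E`. -/
def Smooth : Subalgebra ℝ (E → ℝ) where
  carrier := {f | ContDiff ℝ (⊤ : ℕ∞) f}
  mul_mem' {f g} (hf : ContDiff ℝ (⊤ : ℕ∞) f) (hg : ContDiff ℝ (⊤ : ℕ∞) g) := hf.mul hg
  add_mem' {f g} (hf : ContDiff ℝ (⊤ : ℕ∞) f) (hg : ContDiff ℝ (⊤ : ℕ∞) g) := hf.add hg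
  algebraMap_mem' c := (contDiff_const : ContDiff ℝ (⊤ : ℕ∞) fun _ : E => c)

instance : CoeFun (Smooth E) fun _ => E → ℝ := ⟨Subtype.val⟩

lemma contDiff_smooth (f : Smooth E) : ContDiff ℝ (⊤ : ℕ∞) f := f.2

lemma continuous_smooth (f : Smooth E) : Continuous f := (contDiff_smooth f).continuous

lemma differentiableAt_smooth (f : Smooth E) (p : E) : DifferentiableAt ℝ f p :=
  (contDiff_smooth f).differentiable (by simp) p

@[simp] lemma Smooth.add_apply (f g : Smooth E) (p : E) : (f + g) p = f p + g p := rfl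
@[simp] lemma Smooth.sub_apply (f g : Smooth E) (p : E) : (f - g) p = f p - g p := rfl
@[simp] lemma Smooth.neg_apply (f : Smooth E) (p : E) : (-f) p = -f p := rfl
@[simp] lemma Smooth.mul_apply (f g : Smooth E) (p : E) : (f * g) p = f p * g p := rfl
@[simp] lemma Smooth.smul_apply (c : ℝ) (f : Smooth E) (p : E) : (c • f) p = c * f p := rfl
@[simp] lemma Smooth.zero_apply (p : E) : (0 : Smooth E) p = 0 := rfl

/-- The derivative in the direction `d`. -/
def dirDeriv (d : E) : Smooth E →ₗ[ℝ] Smooth E where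
  toFun f := ⟨fun p => fderiv ℝ f p d,
    ((contDiff_smooth f).fderiv_right (m := ((⊤ : ℕ∞) : WithTop ℕ∞)) le_rfl).clm_apply contDiff_const⟩
  map_add' f g := by
    ext p
    simp only [Smooth.add_apply]
    exact congrArg (fun L => L d) (fderiv_add (differentiableAt_smooth f p) (differentiableAt_smooth g p))
  map_smul' c f := by
    ext p
    exact congrArg (fun L => L d) (fderiv_const_smul (differentiableAt_smooth f p) c)

lemma dirDeriv_apply (d : E) (f : Smooth E) (p : E) : dirDeriv d f p = fderiv ℝ f p d := rfl

lemma dirDeriv_mul (d : E) (f g : Smooth E) :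
    dirDeriv d (f * g) = f * dirDeriv d g + dirDeriv d f * g := by
  ext p
  have := congrArg (fun L => L d) (fderiv_mul (differentiableAt_smooth f p) (differentiableAt_smooth g p))
  refine Eq.trans this ?_
  simp [dirDeriv_apply, mul_comm]

lemma dirDeriv_comm (d d' : E) (f : Smooth E) :
    dirDeriv d (dirDeriv d' f) = dirDeriv d' (dirDeriv d f) := by
  ext p
  have hd : DifferentiableAt ℝ (fderiv ℝ f) p :=
    ((contDiff_smooth f).fderiv_right (m := ((⊤ : ℕ∞) : WithTop ℕ∞)) le_rfl).differentiable (by simp) p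
  have key : ∀ a b : E, fderiv ℝ (fun q => fderiv ℝ f q a) p b =
      fderiv ℝ (fderiv ℝ f) p b a := fun a b => by
    rw [fderiv_clm_apply hd (differentiableAt_const _)]
    simp
  have hs : IsSymmSndFDerivAt ℝ f p :=
    (contDiff_smooth f).contDiffAt.isSymmSndFDerivAt (by simpa using WithTop.coe_le_coe.2 (le_top : (2 : ℕ∞) ≤ ⊤))
  exact (key d' d).trans ((hs d d').trans (key d d').symm)

lemma dirDeriv_add_dir (d d' : E) (f : Smooth E) (p : E) :
    dirDeriv (d + d') f p = dirDeriv d f p + dirDeriv d' f p := by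
  simp [dirDeriv_apply]

lemma dirDeriv_eq_zero {K : Set E} (hK : IsClosed K) (d : E) {f : Smooth E}
    (hf : ∀ p ∉ K, f p = 0) : ∀ p ∉ K, dirDeriv d f p = 0 := fun p hp => by
  have : (f : E → ℝ) =ᶠ[𝓝 p] fun _ => 0 := by
    filter_upwards [hK.isOpen_compl.mem_nhds hp] with q hq using hf q hq
  rw [dirDeriv_apply, this.fderiv_eq]
  simp

end Smooth

/-! ### The shear ansatz and the scalar equations it satisfies -/

section Potential

variable {N : ℕ}

lemma sum_mul_dirDeriv (a : Vec N) (f : Smooth (SpaceTime N)) (p : SpaceTime N) :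
    ∑ j, a j * dirDeriv ((0 : ℝ), EuclideanSpace.single j (1 : ℝ)) f p =
      dirDeriv ((0 : ℝ), a) f p := by
  simp only [dirDeriv_apply]
  have : ((0 : ℝ), a) = ∑ j, a j • ((0 : ℝ), EuclideanSpace.single j (1 : ℝ)) := by
    refine Prod.ext ?_ ?_
    · simp [Prod.fst_sum]
    · ext i
      simp [Prod.snd_sum, Pi.single_apply]
  rw [this, map_sum]
  simp only [map_smul, smul_eq_mul]

/-- The symmetric traceless matrix `(a ⊗ b + b ⊗ a) - 2 (a · b) v ⊗ v` for a unit vector `v`. -/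
def pairMat (a b v : Vec N) (hv : ‖v‖ = 1) : Sym0 N :=
  ⟨fun i j => a i * b j + b i * a j - 2 * ⟪a, b⟫ * (v i * v j),
    Matrix.IsSymm.ext fun i j => by ring, by
    simp only [Matrix.trace, Matrix.diag, Finset.sum_sub_distrib,
      Finset.sum_add_distrib, ← Finset.mul_sum]
    have h1 : ∑ i, a i * b i = ⟪a, b⟫ := by
      simp [PiLp.inner_apply, mul_comm]
    have h2 : ∑ i, v i * v i = 1 := by
      simp_rw [← sq]
      rw [← EuclideanSpace.real_norm_sq_eq, hv, one_pow]
    have h3 : ∑ i, b i * a i = ⟪a, b⟫ := by simp [PiLp.inner_apply]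
    rw [h1, h2, h3]; ring⟩

lemma pairMat_apply (a b v : Vec N) (hv : ‖v‖ = 1) (i j : Fin N) :
    (pairMat a b v hv : Matrix (Fin N) (Fin N) ℝ) i j =
      a i * b j + b i * a j - 2 * ⟪a, b⟫ * (v i * v j) := rfl

/-- The velocity of a localised shear flow. -/
def shearVel (v k : Vec N) (f₁ f₂ : Smooth (SpaceTime N)) : C(SpaceTime N, Vec N) where
  toFun p := f₁ p • v - f₂ p • k
  continuous_toFun := by
    have h₁ := continuous_smooth f₁
    have h₂ := continuous_smooth f₂
    fun_prop

/-- The stress of a localised shear flow. -/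
def shearField (w v k : Vec N) (hv : ‖v‖ = 1) (f₁ f₂ f₃ f₄ : Smooth (SpaceTime N)) :
    C(SpaceTime N, Sym0 N) where
  toFun p := f₁ p • pairMat w v v hv - f₂ p • pairMat w k v hv + f₃ p • pairMat v k v hv +
    f₄ p • ((1 / 2 : ℝ) • pairMat k k v hv)
  continuous_toFun := by
    have h₁ := continuous_smooth f₁
    have h₂ := continuous_smooth f₂
    have h₃ := continuous_smooth f₃
    have h₄ := continuous_smooth f₄
    exact (((h₁.smul continuous_const).sub (h₂.smul continuous_const)).add
      (h₃.smul continuous_const)).add (h₄.smul continuous_const)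

lemma shearField_apply (w v k : Vec N) (hv : ‖v‖ = 1) (hk : ‖k‖ = 1) (hvk : ⟪v, k⟫ = 0)
    (f₁ f₂ f₃ f₄ : Smooth (SpaceTime N)) (p : SpaceTime N) (i j : Fin N) :
    (shearField w v k hv f₁ f₂ f₃ f₄ p : Matrix (Fin N) (Fin N) ℝ) i j =
      ((w j * v i + v j * w i) • f₁ - (w j * k i + k j * w i) • f₂ + (v j * k i + k j * v i) • f₃ +
        (k j * k i) • f₄ +
        (v j * v i) • ((-2 * ⟪w, v⟫) • f₁ + (2 * ⟪w, k⟫) • f₂ - f₄) : Smooth (SpaceTime N)) p := by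
  change f₁ p * (pairMat w v v hv : Matrix (Fin N) (Fin N) ℝ) i j -
    f₂ p * (pairMat w k v hv : Matrix (Fin N) (Fin N) ℝ) i j +
    f₃ p * (pairMat v k v hv : Matrix (Fin N) (Fin N) ℝ) i j +
    f₄ p * (1 / 2 * (pairMat k k v hv : Matrix (Fin N) (Fin N) ℝ) i j) = _
  simp only [pairMat_apply, hvk, real_inner_self_eq_norm_sq, hk, Smooth.add_apply,
    Smooth.sub_apply, Smooth.smul_apply]
  ring

/-- Writing `∂_t` as the derivative along `(1, w)` minus that along `(0, w)`, the momentum equation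
splits into components along `v`, `k` and `w`, which are `h₂`, `h₃` and `h₁`; `h₁` is also the
divergence condition. The coefficient of `v ⊗ v` in `h₂` is the one forced by zero trace. -/
lemma solvesLinear_shear (w v k : Vec N) (hv : ‖v‖ = 1) (hk : ‖k‖ = 1) (hvk : ⟪v, k⟫ = 0)
    (f₁ f₂ f₃ f₄ : Smooth (SpaceTime N))
    (h₁ : dirDeriv (0, v) f₁ = dirDeriv (0, k) f₂)
    (h₂ : dirDeriv (1, w) f₁ + dirDeriv (0, k) f₃ +
      dirDeriv (0, v) ((-2 * ⟪w, v⟫) • f₁ + (2 * ⟪w, k⟫) • f₂ - f₄) = 0)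
    (h₃ : -dirDeriv (1, w) f₂ + dirDeriv (0, v) f₃ + dirDeriv (0, k) f₄ = 0) :
    SolvesLinear (shearVel v k f₁ f₂) (shearField w v k hv f₁ f₂ f₃ f₄) := by
  intro p _
  set f₅ := (-2 * ⟪w, v⟫) • f₁ + (2 * ⟪w, k⟫) • f₂ - f₄ with hf₅
  have hvel : ∀ i, (fun q => shearVel v k f₁ f₂ q i) = (v i • f₁ - k i • f₂ : Smooth _) := by
    intro i
    ext q
    simp [shearVel, mul_comm]
  have hfield : ∀ i j, (fun q => (shearField w v k hv f₁ f₂ f₃ f₄ q : Matrix (Fin N) (Fin N) ℝ) i j)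
      = ((w j * v i + v j * w i) • f₁ - (w j * k i + k j * w i) • f₂ +
        (v j * k i + k j * v i) • f₃ + (k j * k i) • f₄ + (v j * v i) • f₅ : Smooth _) := by
    intro i j
    ext q
    exact shearField_apply w v k hv hk hvk f₁ f₂ f₃ f₄ q i j
  have hT : ∀ f : Smooth (SpaceTime N), dirDeriv (1, 0) f p =
      dirDeriv (1, w) f p - dirDeriv (0, w) f p := fun f => by
    rw [eq_sub_iff_add_eq, ← dirDeriv_add_dir]; simp
  have e₁ := congrArg (fun f : Smooth _ => f p) h₁
  have e₂ := congrArg (fun f : Smooth _ => f p) h₂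
  have e₃ := congrArg (fun f : Smooth _ => f p) h₃
  simp only [Smooth.add_apply, Smooth.neg_apply, Smooth.zero_apply] at e₁ e₂ e₃
  constructor
  · intro i
    simp only [dt, dx, hvel, hfield]
    simp only [← dirDeriv_apply, map_add, map_sub, map_smul, Smooth.add_apply, Smooth.sub_apply,
      Smooth.smul_apply]
    have hsum : ∀ (a b : Vec N) (f : Smooth (SpaceTime N)),
        ∑ j, (a j * b i) * dirDeriv ((0 : ℝ), EuclideanSpace.single j (1 : ℝ)) f p =
          b i * dirDeriv ((0 : ℝ), a) f p := fun a b f => by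
      rw [← sum_mul_dirDeriv, Finset.mul_sum]
      exact Finset.sum_congr rfl fun j _ => by ring
    simp only [add_mul, Finset.sum_add_distrib, Finset.sum_sub_distrib, hsum, hT]
    linear_combination v i * e₂ + k i * e₃ + w i * e₁
  · simp only [dx, hvel]
    simp only [← dirDeriv_apply, map_sub, map_smul, Smooth.sub_apply, Smooth.smul_apply,
      Finset.sum_sub_distrib, sum_mul_dirDeriv]
    linarith

lemma contDiff_shearVel (v k : Vec N) (f₁ f₂ : Smooth (SpaceTime N)) :
    ContDiff ℝ (⊤ : ℕ∞) (shearVel v k f₁ f₂) :=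
  ((contDiff_smooth f₁).smul contDiff_const).sub ((contDiff_smooth f₂).smul contDiff_const)

lemma hasCompactSupport_of_eq_zero {X : Type*} [Zero X] {K : Set (SpaceTime N)} (hK : IsCompact K)
    (hKQ : K ⊆ Q N) {f : SpaceTime N → X} (hf : ∀ p ∉ K, f p = 0) :
    HasCompactSupport f ∧ tsupport f ⊆ Q N := by
  refine ⟨HasCompactSupport.intro hK hf, (closure_minimal ?_ hK.isClosed).trans hKQ⟩
  intro p hp
  by_contra h
  exact hp (hf p h)

lemma isTest_shear {K : Set (SpaceTime N)} (hK : IsCompact K) (hKQ : K ⊆ Q N) (w v k : Vec N)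
    (hv : ‖v‖ = 1) (hk : ‖k‖ = 1) (hvk : ⟪v, k⟫ = 0) {f₁ f₂ f₃ f₄ : Smooth (SpaceTime N)}
    (h₁ : ∀ p ∉ K, f₁ p = 0) (h₂ : ∀ p ∉ K, f₂ p = 0) (h₃ : ∀ p ∉ K, f₃ p = 0)
    (h₄ : ∀ p ∉ K, f₄ p = 0) :
    IsTestVec (shearVel v k f₁ f₂) ∧ IsTestMat (shearField w v k hv f₁ f₂ f₃ f₄) := by
  refine ⟨⟨contDiff_shearVel v k f₁ f₂, hasCompactSupport_of_eq_zero hK hKQ fun p hp => ?_⟩,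
    fun i j => ?_, hasCompactSupport_of_eq_zero hK hKQ fun p hp => ?_⟩
  · change f₁ p • v - f₂ p • k = 0
    simp [h₁ p hp, h₂ p hp]
  · simp_rw [shearField_apply w v k hv hk hvk]
    exact contDiff_smooth _
  · change f₁ p • _ - f₂ p • _ + f₃ p • _ + f₄ p • _ = (0 : Sym0 N)
    simp [h₁ p hp, h₂ p hp, h₃ p hp, h₄ p hp]

end Potential

/-! ### Fourth-order potentials for the localised system -/

section Potentials

variable {M : Type*} [AddCommGroup M] [Module ℝ M]

/-- First scalar potential: the main component of the velocity. -/
def pot₁ (X Y : M →ₗ[ℝ] M) (φ : M) : M := Y (Y (Y (Y φ))) + Y (Y (X (X φ)))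

/-- Second scalar potential: the corrector making the velocity solenoidal. -/
def pot₂ (X Y : M →ₗ[ℝ] M) (φ : M) : M := X (Y (X (X φ))) + X (Y (Y (Y φ)))

/-- The potential restoring the trace condition. -/
def potTrace (X Y T : M →ₗ[ℝ] M) (α β : ℝ) (φ : M) : M :=
  (2 * α) • Y (Y φ) - (2 * β) • X (Y φ) + (2 : ℝ) • X (T φ)

/-- Third scalar potential. -/
def pot₃ (X Y T : M →ₗ[ℝ] M) (α β : ℝ) (φ : M) : M :=
  X (Y (potTrace X Y T α β φ)) - (Y (T (X (X φ))) + Y (T (Y (Y φ))))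

/-- Fourth scalar potential. -/
def pot₄ (X Y T : M →ₗ[ℝ] M) (α β : ℝ) (φ : M) : M :=
  (2 : ℝ) • (X (T (X (X φ))) + X (T (Y (Y φ)))) - X (X (potTrace X Y T α β φ))

/-- Put `L = X² + Y²`, so that `pot₁ = Y²Lφ` and `pot₂ = XYLφ`. The function `Θ = potTrace` enters
like an Airy stress function and cancels in the third identity. The second reduces to `X` applied to
`LΘ = L(2αY² - 2βXY + 2XT)φ`. The factor `L` in `pot₁` and `pot₂` is what lets a differential
operator solve this trace equation, keeping supports compact. -/
lemma potential_identities {X Y T : M →ₗ[ℝ] M} (hYX : ∀ f, Y (X f) = X (Y f))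
    (hTX : ∀ f, T (X f) = X (T f)) (hTY : ∀ f, T (Y f) = Y (T f)) (α β : ℝ) (φ : M) :
    X (pot₁ X Y φ) = Y (pot₂ X Y φ) ∧
    T (pot₁ X Y φ) + Y (pot₃ X Y T α β φ) +
      X ((-2 * α) • pot₁ X Y φ + (2 * β) • pot₂ X Y φ - pot₄ X Y T α β φ) = 0 ∧
    -T (pot₂ X Y φ) + X (pot₃ X Y T α β φ) + Y (pot₄ X Y T α β φ) = 0 := by
  refine ⟨?_, ?_, ?_⟩ <;>
    simp only [pot₁, pot₂, pot₃, pot₄, potTrace, map_add, map_sub, map_smul, hYX, hTX, hTY] <;>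
    module

end Potentials

/-! ### Order calculus for oscillating functions -/

section Oscillation

variable {E : Type*} [NormedAddCommGroup E] [NormedSpace ℝ E]

/-- The function `cos (n ℓ)`. -/
def cosWave (ℓ : E →L[ℝ] ℝ) (n : ℕ) : Smooth E :=
  ⟨fun p => Real.cos (n * ℓ p), (contDiff_const.mul ℓ.contDiff : ContDiff ℝ (⊤ : ℕ∞) fun p => (n : ℝ) * ℓ p).cos⟩

/-- The function `sin (n ℓ)`. -/
def sinWave (ℓ : E →L[ℝ] ℝ) (n : ℕ) : Smooth E :=
  ⟨fun p => Real.sin (n * ℓ p), (contDiff_const.mul ℓ.contDiff : ContDiff ℝ (⊤ : ℕ∞) fun p => (n : ℝ) * ℓ p).sin⟩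

lemma cosWave_apply (ℓ : E →L[ℝ] ℝ) (n : ℕ) (p : E) : cosWave ℓ n p = Real.cos (n * ℓ p) := rfl

lemma sinWave_apply (ℓ : E →L[ℝ] ℝ) (n : ℕ) (p : E) : sinWave ℓ n p = Real.sin (n * ℓ p) := rfl

lemma dirDeriv_cosWave (ℓ : E →L[ℝ] ℝ) (n : ℕ) (d : E) :
    dirDeriv d (cosWave ℓ n) = (-(ℓ d)) • ((n : ℝ) • sinWave ℓ n) := by
  ext p
  have h : HasFDerivAt (fun q => (n : ℝ) * ℓ q) ((n : ℝ) • ℓ) p := ℓ.hasFDerivAt.const_mul _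
  have := congrArg (fun L => L d) h.cos.fderiv
  refine Eq.trans this ?_
  simp [sinWave_apply]
  ring

lemma dirDeriv_sinWave (ℓ : E →L[ℝ] ℝ) (n : ℕ) (d : E) :
    dirDeriv d (sinWave ℓ n) = (ℓ d) • ((n : ℝ) • cosWave ℓ n) := by
  ext p
  have h : HasFDerivAt (fun q => (n : ℝ) * ℓ q) ((n : ℝ) • ℓ) p := ℓ.hasFDerivAt.const_mul _
  have := congrArg (fun L => L d) h.sin.fderiv
  refine Eq.trans this ?_
  simp [cosWave_apply]
  ring

/-- Sequences of smooth functions oscillating with the phase `n ℓ`, supported in `K`, whose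
amplitude grows at most like `n ^ m`. -/
inductive Osc (ℓ : E →L[ℝ] ℝ) (K : Set E) : ℕ → (ℕ → Smooth E) → Prop
  | cos {a : Smooth E} (ha : ∀ p ∉ K, a p = 0) : Osc ℓ K 0 fun n => a * cosWave ℓ n
  | sin {a : Smooth E} (ha : ∀ p ∉ K, a p = 0) : Osc ℓ K 0 fun n => a * sinWave ℓ n
  | add {m : ℕ} {f g : ℕ → Smooth E} (hf : Osc ℓ K m f) (hg : Osc ℓ K m g) :
      Osc ℓ K m fun n => f n + g n
  | smul {m : ℕ} {f : ℕ → Smooth E} (c : ℝ) (hf : Osc ℓ K m f) : Osc ℓ K m fun n => c • f n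
  | nsmul {m : ℕ} {f : ℕ → Smooth E} (hf : Osc ℓ K m f) :
      Osc ℓ K (m + 1) fun n => (n : ℝ) • f n
  | succ {m : ℕ} {f : ℕ → Smooth E} (hf : Osc ℓ K m f) : Osc ℓ K (m + 1) f

namespace Osc

variable {ℓ : E →L[ℝ] ℝ} {K : Set E} {m : ℕ} {f g : ℕ → Smooth E}

lemma sub (hf : Osc ℓ K m f) (hg : Osc ℓ K m g) : Osc ℓ K m fun n => f n - g n := by
  have := hf.add (hg.smul (-1))
  simpa [sub_eq_add_neg] using this

lemma mono (hf : Osc ℓ K m f) {m' : ℕ} (h : m ≤ m') : Osc ℓ K m' f := by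
  induction h with
  | refl => exact hf
  | step _ ih => exact ih.succ

lemma eq_zero (hf : Osc ℓ K m f) (n : ℕ) : ∀ p ∉ K, f n p = 0 := by
  intro p hp
  induction hf with
  | cos ha => simp [ha p hp]
  | sin ha => simp [ha p hp]
  | add _ _ ihf ihg => simp [ihf, ihg]
  | smul c _ ih => simp [ih]
  | nsmul _ ih => simp [ih]
  | succ _ ih => exact ih

lemma bound (hK : IsCompact K) (hf : Osc ℓ K m f) :
    ∃ C : ℝ, 0 ≤ C ∧ ∀ n : ℕ, 1 ≤ n → ∀ p, |f n p| ≤ C * (n : ℝ) ^ m := by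
  have hbdd : ∀ a : Smooth E, (∀ p ∉ K, a p = 0) → ∃ C : ℝ, 0 ≤ C ∧ ∀ p, |a p| ≤ C := fun a ha => by
    obtain ⟨C, hC⟩ := hK.exists_bound_of_continuousOn (continuous_smooth a).continuousOn
    refine ⟨max C 0, le_max_right _ _, fun p => ?_⟩
    by_cases hp : p ∈ K
    · exact (hC p hp).trans (le_max_left _ _)
    · simp [ha p hp]
  induction hf with
  | cos ha =>
    obtain ⟨C, hC0, hC⟩ := hbdd _ ha
    refine ⟨C, hC0, fun n _ p => ?_⟩
    rw [Smooth.mul_apply, abs_mul, pow_zero]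
    exact mul_le_mul (hC p) (Real.abs_cos_le_one _) (abs_nonneg _) hC0
  | sin ha =>
    obtain ⟨C, hC0, hC⟩ := hbdd _ ha
    refine ⟨C, hC0, fun n _ p => ?_⟩
    rw [Smooth.mul_apply, abs_mul, pow_zero]
    exact mul_le_mul (hC p) (Real.abs_sin_le_one _) (abs_nonneg _) hC0
  | add _ _ ihf ihg =>
    obtain ⟨C, hC0, hC⟩ := ihf
    obtain ⟨C', hC0', hC'⟩ := ihg
    refine ⟨C + C', by positivity, fun n hn p => ?_⟩
    rw [add_mul]
    exact (abs_add_le _ _).trans (add_le_add (hC n hn p) (hC' n hn p))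
  | smul c _ ih =>
    obtain ⟨C, hC0, hC⟩ := ih
    refine ⟨|c| * C, by positivity, fun n hn p => ?_⟩
    rw [Smooth.smul_apply, abs_mul, mul_assoc]
    exact mul_le_mul_of_nonneg_left (hC n hn p) (abs_nonneg c)
  | nsmul _ ih =>
    obtain ⟨C, hC0, hC⟩ := ih
    refine ⟨C, hC0, fun n hn p => ?_⟩
    rw [Smooth.smul_apply, abs_mul, Nat.abs_cast, pow_succ', ← mul_assoc, mul_comm C, mul_assoc]
    exact mul_le_mul_of_nonneg_left (hC n hn p) (Nat.cast_nonneg n)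
  | @succ m f _ ih =>
    obtain ⟨C, hC0, hC⟩ := ih
    refine ⟨C, hC0, fun n hn p => (hC n hn p).trans ?_⟩
    have : (1 : ℝ) ≤ n := by exact_mod_cast hn
    gcongr
    · omega

/-- A derivative along the kernel of `ℓ` misses the phase and hits only the amplitude, so it costs
no power of `n`. -/
lemma dirDeriv_ker (hK : IsClosed K) {d : E} (hd : ℓ d = 0) (hf : Osc ℓ K m f) :
    Osc ℓ K m fun n => dirDeriv d (f n) := by
  induction hf with
  | cos ha =>
    simpa [dirDeriv_mul, dirDeriv_cosWave, hd] using Osc.cos (dirDeriv_eq_zero hK d ha)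
  | sin ha =>
    simpa [dirDeriv_mul, dirDeriv_sinWave, hd] using Osc.sin (dirDeriv_eq_zero hK d ha)
  | add _ _ ihf ihg => simpa using ihf.add ihg
  | smul c _ ih => simpa using ih.smul c
  | nsmul _ ih => simpa using ih.nsmul
  | succ _ ih => exact ih.succ

lemma dirDeriv (hK : IsClosed K) (d : E) (hf : Osc ℓ K m f) :
    Osc ℓ K (m + 1) fun n => dirDeriv d (f n) := by
  induction hf with
  | cos ha =>
    simpa only [dirDeriv_mul, dirDeriv_cosWave, mul_smul_comm] using
      ((Osc.sin ha).nsmul.smul (-(ℓ d))).add (Osc.cos (dirDeriv_eq_zero hK d ha)).succ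
  | sin ha =>
    simpa only [dirDeriv_mul, dirDeriv_sinWave, mul_smul_comm] using
      ((Osc.cos ha).nsmul.smul (ℓ d)).add (Osc.sin (dirDeriv_eq_zero hK d ha)).succ
  | add _ _ ihf ihg => simpa using ihf.add ihg
  | smul c _ ih => simpa using ih.smul c
  | nsmul _ ih => simpa using ih.nsmul
  | succ _ ih => exact ih.succ

end Osc

lemma exists_osc_second_deriv {ℓ : E →L[ℝ] ℝ} {K : Set E} (hK : IsClosed K) {d : E} (hd : ℓ d = 1)
    {a : Smooth E} (ha : ∀ p ∉ K, a p = 0) :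
    ∃ h : ℕ → Smooth E, Osc ℓ K 1 h ∧ ∀ n, dirDeriv d (dirDeriv d (a * cosWave ℓ n)) =
      (-(n : ℝ) ^ 2) • (a * cosWave ℓ n) + h n := by
  refine ⟨fun n => dirDeriv d (dirDeriv d a) * cosWave ℓ n +
      (-2 : ℝ) • ((n : ℝ) • (dirDeriv d a * sinWave ℓ n)), ?_, fun n => ?_⟩
  · exact (Osc.cos (dirDeriv_eq_zero hK d (dirDeriv_eq_zero hK d ha))).succ.add
      ((Osc.sin (dirDeriv_eq_zero hK d ha)).nsmul.smul (-2))
  · ext p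
    simp only [dirDeriv_mul, dirDeriv_cosWave, dirDeriv_sinWave, hd, map_add, map_smul,
      Smooth.add_apply, Smooth.smul_apply, Smooth.mul_apply, mul_smul_comm]
    ring

/-- Only when all four derivatives fall on the cosine does `n ^ 4` appear, with sign `(-1)² = 1`;
each derivative on the amplitude loses a power of `n`. -/
lemma osc_fourth_deriv {ℓ : E →L[ℝ] ℝ} {K : Set E} (hK : IsClosed K) {d : E} (hd : ℓ d = 1)
    {a : Smooth E} (ha : ∀ p ∉ K, a p = 0) :
    Osc ℓ K 3 fun n => dirDeriv d (dirDeriv d (dirDeriv d (dirDeriv d (a * cosWave ℓ n)))) -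
      (n : ℝ) ^ 4 • (a * cosWave ℓ n) := by
  obtain ⟨h, hh, he⟩ := exists_osc_second_deriv hK hd ha
  have : (fun n : ℕ => dirDeriv d (dirDeriv d (dirDeriv d (dirDeriv d (a * cosWave ℓ n)))) -
      (n : ℝ) ^ 4 • (a * cosWave ℓ n)) =
      fun n : ℕ => (-1 : ℝ) • ((n : ℝ) • ((n : ℝ) • h n)) + dirDeriv d (dirDeriv d (h n)) := by
    ext n : 1
    rw [he, map_add, map_smul, map_add, map_smul, he]
    module
  rw [this]
  exact (hh.nsmul.nsmul.smul (-1)).add ((hh.dirDeriv hK d).dirDeriv hK d)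

/-- The rescaled potentials: a main oscillation in the first one and errors of size `1 / n`. -/
lemma exists_potentials {ℓ : E →L[ℝ] ℝ} {K : Set E} (hK : IsCompact K) {x y t : E}
    (hx : ℓ x = 0) (hy : ℓ y = 1) (ht : ℓ t = 0) (α β r : ℝ) {a : Smooth E}
    (ha : ∀ p ∉ K, a p = 0) :
    ∃ (f₁ f₂ f₃ f₄ : ℕ → Smooth E) (C : ℝ), 0 ≤ C ∧ ∀ n : ℕ, 1 ≤ n →
      (dirDeriv x (f₁ n) = dirDeriv y (f₂ n) ∧
        dirDeriv t (f₁ n) + dirDeriv y (f₃ n) +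
          dirDeriv x ((-2 * α) • f₁ n + (2 * β) • f₂ n - f₄ n) = 0 ∧
        -dirDeriv t (f₂ n) + dirDeriv x (f₃ n) + dirDeriv y (f₄ n) = 0) ∧
      (∀ p ∉ K, f₁ n p = 0 ∧ f₂ n p = 0 ∧ f₃ n p = 0 ∧ f₄ n p = 0) ∧
      ∀ p, |f₁ n p - r * a p * Real.cos (n * ℓ p)| ≤ C / n ∧ |f₂ n p| ≤ C / n ∧
        |f₃ n p| ≤ C / n ∧ |f₄ n p| ≤ C / n := by
  set X := dirDeriv x with hX
  set Y := dirDeriv y with hY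
  set T := dirDeriv t with hT
  have hKc := hK.isClosed
  have o : Osc ℓ K 0 fun n => a * cosWave ℓ n := Osc.cos ha
  have oX : ∀ {m f}, Osc ℓ K m f → Osc ℓ K m fun n => X (f n) := fun h => h.dirDeriv_ker hKc hx
  have oT : ∀ {m f}, Osc ℓ K m f → Osc ℓ K m fun n => T (f n) := fun h => h.dirDeriv_ker hKc ht
  have oY : ∀ {m f}, Osc ℓ K m f → Osc ℓ K (m + 1) fun n => Y (f n) := fun h => h.dirDeriv hKc y
  have o₁ : Osc ℓ K 3 fun n => pot₁ X Y (a * cosWave ℓ n) - (n : ℝ) ^ 4 • (a * cosWave ℓ n) := by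
    have := (osc_fourth_deriv hKc hy ha).add (oY (oY (oX (oX o)))).succ
    refine (congrArg (Osc ℓ K 3) (funext fun n => ?_)).mp this
    simp only [pot₁, ← hY]
    abel
  have o₂ : Osc ℓ K 3 fun n => pot₂ X Y (a * cosWave ℓ n) :=
    ((oX (oY (oX (oX o)))).mono (by omega)).add (oX (oY (oY (oY o))))
  have oΘ : Osc ℓ K 2 fun n => potTrace X Y T α β (a * cosWave ℓ n) :=
    (((oY (oY o)).smul _).sub (((oX (oY o)).mono (by omega)).smul _)).add
      (((oX (oT o)).mono (by omega)).smul _)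
  have o₃ : Osc ℓ K 3 fun n => pot₃ X Y T α β (a * cosWave ℓ n) :=
    (oX (oY oΘ)).sub (((oY (oT (oX (oX o)))).mono (by omega)).add (oY (oT (oY (oY o)))))
  have o₄ : Osc ℓ K 3 fun n => pot₄ X Y T α β (a * cosWave ℓ n) :=
    ((((oX (oT (oX (oX o)))).mono (by omega)).add
      ((oX (oT (oY (oY o)))).mono (by omega))).smul _).sub ((oX (oX oΘ)).mono (by omega))
  obtain ⟨C₁, hC₁, b₁⟩ := o₁.bound hK
  obtain ⟨C₂, hC₂, b₂⟩ := o₂.bound hK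
  obtain ⟨C₃, hC₃, b₃⟩ := o₃.bound hK
  obtain ⟨C₄, hC₄, b₄⟩ := o₄.bound hK
  have hid := fun φ => potential_identities (X := X) (Y := Y) (T := T) (dirDeriv_comm y x)
    (dirDeriv_comm t x) (dirDeriv_comm t y) α β φ
  -- Division by `n ^ 4` leaves amplitude `r` in the main term and turns every remainder, of order
  -- at most `3`, into `O(1 / n)`.
  refine ⟨fun n => (r / (n : ℝ) ^ 4) • pot₁ X Y (a * cosWave ℓ n),
    fun n => (r / (n : ℝ) ^ 4) • pot₂ X Y (a * cosWave ℓ n),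
    fun n => (r / (n : ℝ) ^ 4) • pot₃ X Y T α β (a * cosWave ℓ n),
    fun n => (r / (n : ℝ) ^ 4) • pot₄ X Y T α β (a * cosWave ℓ n),
    |r| * (C₁ + C₂ + C₃ + C₄), by positivity, fun n hn => ⟨⟨?_, ?_, ?_⟩, fun p hp => ?_, fun p => ?_⟩⟩
  · rw [map_smul, map_smul, (hid _).1]
  · have := congrArg (fun f => (r / (n : ℝ) ^ 4) • f) (hid (a * cosWave ℓ n)).2.1
    simp only [smul_zero] at this
    rw [← this]
    simp only [map_add, map_sub, map_smul]
    module
  · have := congrArg (fun f => (r / (n : ℝ) ^ 4) • f) (hid (a * cosWave ℓ n)).2.2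
    simp only [smul_zero] at this
    rw [← this]
    simp only [map_smul]
    module
  · have h₁ := o₁.eq_zero n p hp
    simp only [Smooth.sub_apply, Smooth.smul_apply, Smooth.mul_apply, ha p hp, zero_mul, mul_zero,
      sub_zero] at h₁
    simp [h₁, o₂.eq_zero n p hp, o₃.eq_zero n p hp, o₄.eq_zero n p hp]
  · have hn0 : (0 : ℝ) < n := by exact_mod_cast hn
    have key : ∀ (u c : ℝ), 0 ≤ c → c ≤ C₁ + C₂ + C₃ + C₄ → |u| ≤ c * (n : ℝ) ^ 3 →
        |r / (n : ℝ) ^ 4 * u| ≤ |r| * (C₁ + C₂ + C₃ + C₄) / n := fun u c hc hc' hu => by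
      rw [abs_mul, abs_div, abs_of_pos (by positivity : 0 < (n : ℝ) ^ 4)]
      calc |r| / (n : ℝ) ^ 4 * |u| ≤ |r| / (n : ℝ) ^ 4 * ((C₁ + C₂ + C₃ + C₄) * (n : ℝ) ^ 3) := by
            gcongr; exact hu.trans (by gcongr)
        _ = _ := by field_simp
    refine ⟨?_, key _ C₂ hC₂ (by linarith) (b₂ n hn p), key _ C₃ hC₃ (by linarith) (b₃ n hn p),
      key _ C₄ hC₄ (by linarith) (b₄ n hn p)⟩
    refine le_trans (le_of_eq ?_) (key _ C₁ hC₁ (by linarith) (b₁ n hn p))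
    congr 1
    simp only [Smooth.sub_apply, Smooth.smul_apply, Smooth.mul_apply, cosWave_apply]
    field_simp

end Oscillation

/-! ### Riemann–Lebesgue along a fixed phase -/

section RiemannLebesgue

variable {E : Type*} [NormedAddCommGroup E] [NormedSpace ℝ E] [FiniteDimensional ℝ E]
  [MeasurableSpace E] [BorelSpace E]

lemma tendsto_integral_cos_sin (μ : Measure E) [μ.IsAddHaarMeasure] {h : E → ℝ}
    (hh : Integrable h μ) {ℓ : E →L[ℝ] ℝ} (hℓ : ℓ ≠ 0) :
    Tendsto (fun n : ℕ => ∫ p, h p * Real.cos (n * ℓ p) ∂μ) atTop (𝓝 0) ∧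
      Tendsto (fun n : ℕ => ∫ p, h p * Real.sin (n * ℓ p) ∂μ) atTop (𝓝 0) := by
  -- The factor `-1 / (2π)` undoes the sign and the `2π` of the Fourier kernel; the cosine and sine
  -- integrals are then the real and imaginary parts.
  have hn : Tendsto (fun n : ℕ => (-((n : ℝ) / (2 * Real.pi))) • ℓ) atTop
      (cocompact (StrongDual ℝ E)) := by
    refine Tendsto.mono_right ?_ Metric.cobounded_le_cocompact
    rw [← tendsto_norm_atTop_iff_cobounded]
    simp_rw [norm_smul, norm_neg]
    refine Tendsto.atTop_mul_const (norm_pos_iff.2 hℓ) ?_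
    refine tendsto_norm_atTop_atTop.comp ?_
    exact tendsto_natCast_atTop_atTop.atTop_div_const (by positivity)
  have hform : ∀ n : ℕ, ∀ p,
      Real.fourierChar (-((-((n : ℝ) / (2 * Real.pi))) • ℓ) p) • (h p : ℂ) =
        ((h p * Real.cos (n * ℓ p) : ℝ) : ℂ) + ((h p * Real.sin (n * ℓ p) : ℝ) : ℂ) * Complex.I := by
    intro n p
    have : ((2 * Real.pi * (-((-((n : ℝ) / (2 * Real.pi))) • ℓ) p) : ℝ) : ℂ) =
        ((n * ℓ p : ℝ) : ℂ) := by
      congr 1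
      simp only [FunLike.coe_smul, Pi.smul_apply, smul_eq_mul]
      field_simp
    rw [Circle.smul_def, Real.fourierChar_apply, this, Complex.exp_mul_I, smul_eq_mul]
    push_cast
    ring
  have hc : ∀ n : ℕ, Integrable (fun p => h p * Real.cos (n * ℓ p)) μ := fun n =>
    hh.mul_bdd (c := 1) (Continuous.aestronglyMeasurable (by fun_prop))
      (ae_of_all _ fun p => Real.abs_cos_le_one _)
  have hs : ∀ n : ℕ, Integrable (fun p => h p * Real.sin (n * ℓ p)) μ := fun n =>
    hh.mul_bdd (c := 1) (Continuous.aestronglyMeasurable (by fun_prop))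
      (ae_of_all _ fun p => Real.abs_sin_le_one _)
  have hval : ∀ n : ℕ, ∫ p, Real.fourierChar (-((-((n : ℝ) / (2 * Real.pi))) • ℓ) p) • (h p : ℂ) ∂μ =
      ((∫ p, h p * Real.cos (n * ℓ p) ∂μ : ℝ) : ℂ) +
        ((∫ p, h p * Real.sin (n * ℓ p) ∂μ : ℝ) : ℂ) * Complex.I := fun n => by
    simp_rw [hform]
    rw [integral_add (hc n).ofReal ((hs n).ofReal.mul_const _), integral_mul_const,
      integral_complex_ofReal, integral_complex_ofReal]
  have hlim := (tendsto_integral_exp_smul_cocompact (fun p => (h p : ℂ)) μ).comp hn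
  have hlim' : Tendsto (fun n : ℕ => ((∫ p, h p * Real.cos (n * ℓ p) ∂μ : ℝ) : ℂ) +
      ((∫ p, h p * Real.sin (n * ℓ p) ∂μ : ℝ) : ℂ) * Complex.I) atTop (𝓝 0) := by
    refine hlim.congr fun n => ?_
    exact hval n
  constructor
  · simpa [Function.comp_def] using (Complex.continuous_re.tendsto _).comp hlim'
  · simpa [Function.comp_def] using (Complex.continuous_im.tendsto _).comp hlim'

end RiemannLebesgue

/-! ### The space-time cutoff -/

section Cutoff

lemma isCompact_cube (N : ℕ) : IsCompact (cube N) := by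
  have : cube N = (EuclideanSpace.equiv (Fin N) ℝ).toHomeomorph ⁻¹'
      (Set.pi univ fun _ => Icc (0 : ℝ) 1) := by
    ext x
    simp only [cube, mem_preimage, mem_univ_pi]
    rfl
  rw [this, Homeomorph.isCompact_preimage]
  exact isCompact_univ_pi fun _ => isCompact_Icc

lemma isOpen_Q (N : ℕ) : IsOpen (Q N) := by
  have : Q N = Prod.fst ⁻¹' Ioo (0 : ℝ) 1 ∩ ⋂ i, (fun p : SpaceTime N => p.2 i) ⁻¹' Ioo (0 : ℝ) 1 := by
    ext p; simp [Q]
  rw [this]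
  refine (isOpen_Ioo.preimage continuous_fst).inter (isOpen_iInter_of_finite fun i => ?_)
  exact isOpen_Ioo.preimage (by fun_prop)

lemma volume_Q_ne_top (N : ℕ) : volume (Q N) ≠ ⊤ := by
  refine ne_top_of_le_ne_top ((isCompact_Icc (a := (0 : ℝ)) (b := 1)).prod
    (isCompact_cube N)).measure_ne_top (measure_mono fun p hp => ⟨Ioo_subset_Icc_self hp.1, fun i =>
      Ioo_subset_Icc_self (hp.2 i)⟩)

/-- The centre of the spatial unit cube. -/
def centre (N : ℕ) : Vec N := WithLp.toLp 2 fun _ => 1 / 2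

/-- The temporal cutoff. -/
def timeBump : ContDiffBump (1 / 2 : ℝ) := ⟨1 / 6, 1 / 3, by norm_num, by norm_num⟩

/-- The spatial cutoff. -/
def spaceBump (N : ℕ) : ContDiffBump (centre N) := ⟨1 / 6, 1 / 3, by norm_num, by norm_num⟩

/-- The space-time cutoff. -/
def cutoff (N : ℕ) : Smooth (SpaceTime N) :=
  ⟨fun p => timeBump p.1 * spaceBump N p.2,
    ((timeBump.contDiff.comp contDiff_fst).mul ((spaceBump N).contDiff.comp contDiff_snd) :
      ContDiff ℝ (⊤ : ℕ∞) fun p : SpaceTime N => timeBump p.1 * spaceBump N p.2)⟩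

lemma cutoff_apply {N : ℕ} (p : SpaceTime N) : cutoff N p = timeBump p.1 * spaceBump N p.2 := rfl

/-- A compact set containing the support of the cutoff. -/
def cutoffSupport (N : ℕ) : Set (SpaceTime N) :=
  Metric.closedBall (1 / 2) (1 / 3) ×ˢ Metric.closedBall (centre N) (1 / 3)

lemma isCompact_cutoffSupport (N : ℕ) : IsCompact (cutoffSupport N) :=
  (isCompact_closedBall _ _).prod (isCompact_closedBall _ _)

/-- The radius `1 / 3` is below `1 / 2`, and each coordinate is bounded by the Euclidean norm. -/
lemma cutoffSupport_subset (N : ℕ) : cutoffSupport N ⊆ Q N := by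
  rintro ⟨t, x⟩ ⟨ht, hx⟩
  have h : ∀ s : ℝ, |s - 1 / 2| ≤ 1 / 3 → s ∈ Ioo (0 : ℝ) 1 := fun s hs => by
    rw [abs_le] at hs
    constructor <;> linarith
  refine ⟨h t ht, fun i => h _ ?_⟩
  rw [mem_closedBall_iff_norm] at hx
  exact (PiLp.norm_apply_le (x - centre N) i).trans hx

lemma cutoff_eq_zero {N : ℕ} : ∀ p ∉ cutoffSupport N, cutoff N p = 0 := by
  rintro ⟨t, x⟩ hp
  rw [cutoff_apply, mul_eq_zero]
  by_contra! h
  refine hp ⟨?_, ?_⟩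
  · by_contra hc
    exact h.1 (timeBump.zero_of_le_dist (not_le.1 hc).le)
  · by_contra hc
    exact h.2 ((spaceBump N).zero_of_le_dist (not_le.1 hc).le)

lemma abs_cutoff_le {N : ℕ} (p : SpaceTime N) : |cutoff N p| ≤ 1 := by
  rw [cutoff_apply, abs_mul, abs_of_nonneg timeBump.nonneg, abs_of_nonneg (spaceBump N).nonneg]
  exact mul_le_one₀ timeBump.le_one (spaceBump N).nonneg (spaceBump N).le_one

/-- The mean square of the cutoff. -/
def cutoffEnergy (N : ℕ) : ℝ := ⨍ p in Q N, cutoff N p ^ 2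

lemma integrableOn_Q_of_continuous {N : ℕ} {f : SpaceTime N → ℝ} (hf : Continuous f) :
    IntegrableOn f (Q N) :=
  (hf.continuousOn.integrableOn_compact ((isCompact_Icc (a := (0 : ℝ)) (b := 1)).prod
    (isCompact_cube N))).mono_set fun _ hp => ⟨Ioo_subset_Icc_self hp.1, fun i =>
      Ioo_subset_Icc_self (hp.2 i)⟩

lemma cutoffEnergy_pos (N : ℕ) : 0 < cutoffEnergy N := by
  have hc : ((1 / 2 : ℝ), centre N) ∈ Q N := by
    constructor
    · constructor <;> norm_num
    · intro i
      simp only [centre]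
      constructor <;> norm_num
  have hcont : Continuous fun p => cutoff N p ^ 2 := (continuous_smooth _).pow 2
  have hpos : 0 < volume (Q N) := (isOpen_Q N).measure_pos volume ⟨_, hc⟩
  rw [cutoffEnergy, setAverage_eq, smul_eq_mul]
  refine mul_pos (inv_pos.2 (ENNReal.toReal_pos hpos.ne' (volume_Q_ne_top N))) ?_
  rw [setIntegral_pos_iff_support_of_nonneg_ae (ae_of_all _ fun p => sq_nonneg _)
    (integrableOn_Q_of_continuous hcont)]
  refine ((isOpen_ne_fun hcont continuous_const).inter (isOpen_Q N)).measure_pos volume ⟨_, ?_, hc⟩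
  have h₁ : timeBump (1 / 2) = 1 := timeBump.one_of_mem_closedBall (by simp [timeBump.rIn_pos.le])
  have h₂ : spaceBump N (centre N) = 1 :=
    (spaceBump N).one_of_mem_closedBall (by simp [(spaceBump N).rIn_pos.le])
  simp [cutoff_apply, h₂, -one_div, h₁]

end Cutoff

/-! ### Weak limit and energy of a localised plane wave -/

section Limits

variable {N : ℕ}

/-- The phase of a plane wave with wave vector `k`, transported by `w`. -/
def phase (w k : Vec N) : SpaceTime N →L[ℝ] ℝ :=
  (innerSL ℝ k).comp (ContinuousLinearMap.snd ℝ ℝ (Vec N)) -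
    ⟪w, k⟫ • ContinuousLinearMap.fst ℝ ℝ (Vec N)

lemma phase_apply (w k : Vec N) (p : SpaceTime N) : phase w k p = ⟪k, p.2⟫ - ⟪w, k⟫ * p.1 := rfl

/-- A sequence of continuous fields asymptotic to a localised plane wave. -/
def IsAsymptoticWave (w v k : Vec N) (r : ℝ) (W : ℕ → C(SpaceTime N, Vec N)) (C : ℝ) : Prop :=
  ∀ n : ℕ, 1 ≤ n → ∀ p,
    ‖W n p - (cutoff N p * Real.cos (n * phase w k p) * r) • v‖ ≤ C / n

/-- Uniformity in `t` comes from separating variables. The cutoff is a product and the cosine splits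
by the addition formula, so `t` enters the main term only through bounded factors in front of the
two integrals `A n`, `B n`. -/
lemma IsAsymptoticWave.tendstoZeroCWeak {w v k : Vec N} (hk : ‖k‖ = 1) {r C : ℝ}
    {W : ℕ → C(SpaceTime N, Vec N)} (hW : IsAsymptoticWave w v k r W C) :
    TendstoZeroCWeak fun n => W n := by
  intro g hg
  have hfin : IsFiniteMeasure (volume.restrict (cube N)) :=
    ⟨by simpa using (isCompact_cube N).measure_lt_top⟩
  have hgi : Integrable g (volume.restrict (cube N)) := hg.integrable (by norm_num)
  set h : Vec N → ℝ := fun x => spaceBump N x * ⟪v, g x⟫ with hh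
  have hhi : IntegrableOn h (cube N) := by
    refine (hgi.const_inner v).bdd_mul (c := 1)
      (spaceBump N).continuous.aestronglyMeasurable (ae_of_all _ fun x => ?_)
    rw [Real.norm_of_nonneg (spaceBump N).nonneg]
    exact (spaceBump N).le_one
  have hk0 : innerSL ℝ k ≠ 0 := by
    rw [← norm_pos_iff, innerSL_apply_norm, hk]; exact one_pos
  obtain ⟨hA, hB⟩ := tendsto_integral_cos_sin (volume : Measure (Vec N))
    (hhi.integrable_indicator (isCompact_cube N).measurableSet) hk0
  set A := fun n : ℕ => ∫ x in cube N, h x * Real.cos (n * ⟪k, x⟫) with hAdef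
  set B := fun n : ℕ => ∫ x in cube N, h x * Real.sin (n * ⟪k, x⟫) with hBdef
  have hA' : Tendsto A atTop (𝓝 0) := by
    refine hA.congr fun n => ?_
    simp only [hAdef]
    rw [← integral_indicator (isCompact_cube N).measurableSet]
    refine integral_congr_ae (ae_of_all _ fun x => ?_)
    exact (Set.indicator_mul_left (cube N) h fun x => Real.cos (n * ⟪k, x⟫)).symm
  have hB' : Tendsto B atTop (𝓝 0) := by
    refine hB.congr fun n => ?_
    simp only [hBdef]
    rw [← integral_indicator (isCompact_cube N).measurableSet]
    refine integral_congr_ae (ae_of_all _ fun x => ?_)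
    exact (Set.indicator_mul_left (cube N) h fun x => Real.sin (n * ⟪k, x⟫)).symm
  set I := ∫ x in cube N, ‖g x‖
  have hlim : Tendsto (fun n : ℕ => |r| * (|A n| + |B n|) + C / n * I) atTop (𝓝 0) := by
    simpa using ((hA'.abs.add hB'.abs).const_mul |r|).add
      ((tendsto_const_div_atTop_nhds_zero_nat C).mul_const I)
  rw [Metric.tendstoUniformlyOn_iff]
  intro ε hε
  filter_upwards [hlim.eventually_lt_const hε, eventually_ge_atTop 1] with n hn hn1 t _
  refine lt_of_le_of_lt ?_ hn
  rw [dist_zero_left, Real.norm_eq_abs]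
  set R : Vec N → Vec N := fun x =>
    W n (t, x) - (cutoff N (t, x) * Real.cos (n * phase w k (t, x)) * r) • v with hR
  have hRc : Continuous R := by
    have := continuous_smooth (cutoff N)
    have h' : Continuous fun x : Vec N => cutoff N (t, x) := this.comp (by fun_prop)
    fun_prop
  have hRb : ∀ x, ‖R x‖ ≤ C / n := fun x => hW n hn1 (t, x)
  have hRi : Integrable (fun x => ⟪R x, g x⟫) (volume.restrict (cube N)) := by
    refine (hgi.norm.const_mul (C / n)).mono' (hRc.aestronglyMeasurable.inner hgi.1)
      (ae_of_all _ fun x => ?_)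
    exact (norm_inner_le_norm _ _).trans (mul_le_mul_of_nonneg_right (hRb x) (norm_nonneg _))
  have hci : Integrable (fun x => h x * Real.cos (n * ⟪k, x⟫)) (volume.restrict (cube N)) :=
    Integrable.mul_bdd (c := 1) hhi (Continuous.aestronglyMeasurable (by fun_prop))
      (ae_of_all _ fun p => Real.abs_cos_le_one _)
  have hsi : Integrable (fun x => h x * Real.sin (n * ⟪k, x⟫)) (volume.restrict (cube N)) :=
    Integrable.mul_bdd (c := 1) hhi (Continuous.aestronglyMeasurable (by fun_prop))
      (ae_of_all _ fun p => Real.abs_sin_le_one _)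
  have hpt : ∀ x, ⟪W n (t, x), g x⟫ =
      (r * timeBump t * Real.cos (n * (⟪w, k⟫ * t))) * (h x * Real.cos (n * ⟪k, x⟫)) +
      (r * timeBump t * Real.sin (n * (⟪w, k⟫ * t))) * (h x * Real.sin (n * ⟪k, x⟫)) +
      ⟪R x, g x⟫ := fun x => by
    simp only [hR, inner_sub_left, inner_smul_left, phase_apply, cutoff_apply, mul_sub,
      Real.cos_sub, hh]
    simp
    ring
  have hint : ∫ x in cube N, ⟪W n (t, x), g x⟫ =
      (r * timeBump t * Real.cos (n * (⟪w, k⟫ * t))) * A n +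
      (r * timeBump t * Real.sin (n * (⟪w, k⟫ * t))) * B n + ∫ x in cube N, ⟪R x, g x⟫ := by
    rw [integral_congr_ae (ae_of_all _ hpt)]
    refine (integral_add ((hci.const_mul _).add (hsi.const_mul _)) hRi).trans ?_
    congr 1
    refine (integral_add (hci.const_mul _) (hsi.const_mul _)).trans ?_
    rw [integral_const_mul, integral_const_mul]
  have hRint : |∫ x in cube N, ⟪R x, g x⟫| ≤ C / n * I := by
    rw [← integral_const_mul]
    rw [← Real.norm_eq_abs]
    refine norm_integral_le_of_norm_le (hgi.norm.const_mul (C / n)) (ae_of_all _ fun x => ?_)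
    exact (norm_inner_le_norm _ _).trans (mul_le_mul_of_nonneg_right (hRb x) (norm_nonneg _))
  have hcoef : ∀ c : ℝ, |c| ≤ 1 → |r * timeBump t * c| ≤ |r| := fun c hc => by
    rw [abs_mul, abs_mul, abs_of_nonneg timeBump.nonneg, mul_assoc]
    exact mul_le_of_le_one_right (abs_nonneg r) (mul_le_one₀ timeBump.le_one (abs_nonneg c) hc)
  rw [hint, mul_add]
  refine (abs_add_le _ _).trans (add_le_add ((abs_add_le _ _).trans (add_le_add ?_ ?_)) hRint)
  · rw [abs_mul]
    exact mul_le_mul_of_nonneg_right (hcoef _ (Real.abs_cos_le_one _)) (abs_nonneg _)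
  · rw [abs_mul]
    exact mul_le_mul_of_nonneg_right (hcoef _ (Real.abs_sin_le_one _)) (abs_nonneg _)

lemma abs_norm_sq_sub_le {F : Type*} [NormedAddCommGroup F] (x y : F) :
    |‖x‖ ^ 2 - ‖y‖ ^ 2| ≤ ‖x - y‖ * (‖x - y‖ + 2 * ‖y‖) := by
  have h₁ := abs_norm_sub_norm_le x y
  have h₂ : ‖x‖ ≤ ‖x - y‖ + ‖y‖ := norm_le_norm_sub_add x y
  rw [sq_sub_sq, abs_mul, mul_comm, abs_of_nonneg (by positivity : 0 ≤ ‖x‖ + ‖y‖)]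
  exact mul_le_mul h₁ (by linarith) (by positivity) (norm_nonneg _)

/-- By `cos² = (1 + cos 2·)/2`, half of `r²` times the squared cutoff survives and the part with
doubled phase vanishes by Riemann–Lebesgue. -/
lemma IsAsymptoticWave.tendsto_energy {w v k : Vec N} (hv : ‖v‖ = 1) (hk : ‖k‖ = 1) {r C : ℝ}
    (hC : 0 ≤ C) {W : ℕ → C(SpaceTime N, Vec N)} (hW : IsAsymptoticWave w v k r W C) :
    Tendsto (fun n => ⨍ p in Q N, ‖W n p‖ ^ 2) atTop (𝓝 (r ^ 2 * cutoffEnergy N / 2)) := by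
  have hχ := continuous_smooth (cutoff N)
  have hℓ : (2 : ℝ) • phase w k ≠ 0 := fun h => by
    have := congrArg (fun L => L ((0 : ℝ), k)) h
    simp [phase_apply, hk] at this
  have : (volume : Measure (SpaceTime N)).IsAddHaarMeasure :=
    inferInstanceAs ((volume : Measure ℝ).prod (volume : Measure (Vec N))).IsAddHaarMeasure
  have hQm := (isOpen_Q N).measurableSet
  have hχi : IntegrableOn (fun p => cutoff N p ^ 2) (Q N) := integrableOn_Q_of_continuous (hχ.pow 2)
  obtain ⟨hA, -⟩ := tendsto_integral_cos_sin (volume : Measure (SpaceTime N))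
    (hχi.integrable_indicator hQm) hℓ
  set A := fun n : ℕ => ∫ p in Q N, cutoff N p ^ 2 * Real.cos (n * ((2 : ℝ) • phase w k) p)
    with hAdef
  have hA' : Tendsto A atTop (𝓝 0) := by
    refine hA.congr fun n => ?_
    simp only [hAdef]
    rw [← integral_indicator hQm]
    refine integral_congr_ae (ae_of_all _ fun x => ?_)
    exact (Set.indicator_mul_left (Q N) (fun p => cutoff N p ^ 2)
      fun p => Real.cos (n * ((2 : ℝ) • phase w k) p)).symm
  set J := ∫ p in Q N, cutoff N p ^ 2 with hJ
  have hbound : ∀ n : ℕ, 1 ≤ n → |(∫ p in Q N, ‖W n p‖ ^ 2) - (r ^ 2 / 2 * J + r ^ 2 / 2 * A n)| ≤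
      C * (C + 2 * |r|) * volume.real (Q N) / n := by
    intro n hn
    have hn0 : (1 : ℝ) ≤ n := by exact_mod_cast hn
    have hmain : r ^ 2 / 2 * J + r ^ 2 / 2 * A n = ∫ p in Q N,
        ‖(cutoff N p * Real.cos (n * phase w k p) * r) • v‖ ^ 2 := by
      rw [hJ, hAdef, ← integral_const_mul, ← integral_const_mul, ← integral_add]
      · refine integral_congr_ae (ae_of_all _ fun p => ?_)
        simp only [norm_smul, hv, FunLike.coe_smul, Pi.smul_apply, smul_eq_mul, mul_one,
          Real.norm_eq_abs, sq_abs]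
        rw [show (n : ℝ) * (2 * phase w k p) = 2 * (n * phase w k p) by ring, Real.cos_two_mul]
        ring
      · exact hχi.const_mul _
      · exact integrableOn_Q_of_continuous (by fun_prop)
    rw [hmain, ← integral_sub]
    · rw [← Real.norm_eq_abs]
      refine le_trans (b := C * (C + 2 * |r|) / n * volume.real (Q N))
        (norm_setIntegral_le_of_norm_le_const (volume_Q_ne_top N).lt_top fun p _ => ?_)
        (le_of_eq (by ring))
      rw [Real.norm_eq_abs]
      refine (abs_norm_sq_sub_le _ _).trans ?_
      have h₁ : ‖(cutoff N p * Real.cos (n * phase w k p) * r) • v‖ ≤ |r| := by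
        rw [norm_smul, hv, mul_one, Real.norm_eq_abs, abs_mul, abs_mul]
        exact mul_le_of_le_one_left (abs_nonneg r)
          (mul_le_one₀ (abs_cutoff_le p) (abs_nonneg _) (Real.abs_cos_le_one _))
      have h₂ := hW n hn p
      have h₃ : C / n ≤ C := div_le_self hC hn0
      calc _ ≤ C / n * (C + 2 * |r|) := by gcongr; exact h₂.trans h₃
        _ = _ := by ring
    · exact integrableOn_Q_of_continuous (by fun_prop)
    · exact integrableOn_Q_of_continuous (by fun_prop)
  have hlim : Tendsto (fun n => ∫ p in Q N, ‖W n p‖ ^ 2) atTop (𝓝 (r ^ 2 / 2 * J)) := by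
    have h₁ : Tendsto (fun n : ℕ => r ^ 2 / 2 * J + r ^ 2 / 2 * A n) atTop (𝓝 (r ^ 2 / 2 * J)) := by
      simpa using tendsto_const_nhds.add (hA'.const_mul (r ^ 2 / 2))
    have h₂ : Tendsto (fun n => (∫ p in Q N, ‖W n p‖ ^ 2) - (r ^ 2 / 2 * J + r ^ 2 / 2 * A n)) atTop
        (𝓝 0) :=
      squeeze_zero_norm' (by filter_upwards [eventually_ge_atTop 1] with n hn using hbound n hn)
        (tendsto_const_div_atTop_nhds_zero_nat _)
    simpa using h₂.add h₁
  have := hlim.const_mul (volume.real (Q N))⁻¹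
  simp_rw [setAverage_eq, smul_eq_mul]
  convert this using 2
  rw [cutoffEnergy, setAverage_eq, smul_eq_mul]
  ring

end Limits

/-! ### The oscillatory lemma for constant data -/

section Deterministic

variable {N : ℕ}

/-- The sum of the absolute values of the entries of a matrix. -/
def entrySum (G : Matrix (Fin N) (Fin N) ℝ) : ℝ := ∑ i, ∑ j, |G i j|

lemma entrySum_nonneg (G : Matrix (Fin N) (Fin N) ℝ) : 0 ≤ entrySum G := by
  unfold entrySum; positivity

lemma entrySum_add_le (G G' : Matrix (Fin N) (Fin N) ℝ) :
    entrySum (G + G') ≤ entrySum G + entrySum G' := by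
  simp only [entrySum, ← Finset.sum_add_distrib]
  exact Finset.sum_le_sum fun i _ => Finset.sum_le_sum fun j _ => abs_add_le _ _

lemma entrySum_smul (c : ℝ) (G : Matrix (Fin N) (Fin N) ℝ) :
    entrySum (c • G) = |c| * entrySum G := by
  simp [entrySum, Finset.mul_sum, abs_mul]

lemma entrySum_add_smul_le (G G' : Matrix (Fin N) (Fin N) ℝ) (c : ℝ) :
    entrySum (G + c • G') ≤ entrySum G + |c| * entrySum G' := by
  rw [← entrySum_smul]; exact entrySum_add_le _ _

/-- The amplitude of the oscillations at a point of `S N e`. -/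
def amplitude (N : ℕ) (e : ℝ) (w : Vec N) : ℝ := (e - ‖w‖ ^ 2 / 2) / (4 * N * √e)

/-- The oscillatory lemma for deterministic constant data. -/
lemma exists_oscillation (hN : 2 ≤ N) {e : ℝ} (he : 0 < e) {w : Vec N} {H : Sym0 N}
    (h : (w, H) ∈ S N e) :
    ∃ (W : ℕ → C(SpaceTime N, Vec N)) (V : ℕ → C(SpaceTime N, Sym0 N)) (e' B : ℝ),
      (∀ n, IsTestVec (W n) ∧ IsTestMat (V n)) ∧ (∀ n, SolvesLinear (W n) (V n)) ∧
      TendstoZeroCWeak (fun n => W n) ∧ e' < e ∧ (∀ n p, ‖W n p‖ ≤ B) ∧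
      (∀ n p ξ, stressForm (w + W n p) (H + V n p : Sym0 N) ξ ≤ 2 * e' / N * ‖ξ‖ ^ 2) ∧
      Tendsto (fun n => ⨍ p in Q N, ‖W n p‖ ^ 2) atTop
        (𝓝 (amplitude N e w ^ 2 * cutoffEnergy N / 2)) := by
  obtain ⟨v, k, hv, hk, hvk, e', he', hdir⟩ := exists_direction hN he h
  set r := amplitude N e w with hr
  -- The phase is constant along `v` and along the transport direction `(1, w)`, and has unit slope
  -- along `k`.
  have hx : phase w k (0, v) = 0 := by simp [phase_apply, real_inner_comm, hvk]
  have hy : phase w k (0, k) = 1 := by simp [phase_apply, hk]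
  have ht : phase w k (1, w) = 0 := by simp [phase_apply, real_inner_comm]
  obtain ⟨f₁, f₂, f₃, f₄, C, hC, hf⟩ := exists_potentials (isCompact_cutoffSupport N) hx hy ht
    ⟪w, v⟫ ⟪w, k⟫ r cutoff_eq_zero
  set W : ℕ → C(SpaceTime N, Vec N) := fun n => shearVel v k (f₁ n) (f₂ n) with hW
  set V : ℕ → C(SpaceTime N, Sym0 N) := fun n => shearField w v k hv (f₁ n) (f₂ n) (f₃ n) (f₄ n)
    with hV
  set s : ℕ → SpaceTime N → ℝ := fun n p => cutoff N p * Real.cos (n * phase w k p) with hs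
  have hs1 : ∀ n p, |s n p| ≤ 1 := fun n p => by
    rw [hs, abs_mul]
    exact mul_le_one₀ (abs_cutoff_le p) (abs_nonneg _) (Real.abs_cos_le_one _)
  have hsf : ∀ n : ℕ, 1 ≤ n → ∀ p, |f₁ n p - s n p * r| ≤ C / n := fun n hn p => by
    have := ((hf n hn).2.2 p).1
    rwa [show s n p * r = r * cutoff N p * Real.cos (n * phase w k p) by rw [hs]; ring]
  have hWeq : ∀ n p, W n p - (s n p * r) • v = (f₁ n p - s n p * r) • v - f₂ n p • k :=
    fun n p => by
      change f₁ n p • v - f₂ n p • k - _ = _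
      module
  have hasym : IsAsymptoticWave w v k r W (2 * C) := fun n hn p => by
    change ‖W n p - (s n p * r) • v‖ ≤ _
    rw [hWeq]
    refine (norm_sub_le _ _).trans ?_
    rw [norm_smul, norm_smul, hv, hk, mul_one, mul_one, Real.norm_eq_abs, Real.norm_eq_abs]
    have h₁ := hsf n hn p
    have h₂ := ((hf n hn).2.2 p).2.1
    linarith [mul_div_assoc 2 C (n : ℝ)]
  have hsv : ∀ n p, ‖(s n p * r) • v‖ ≤ |r| := fun n p => by
    rw [norm_smul, hv, mul_one, Real.norm_eq_abs, abs_mul]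
    exact mul_le_of_le_one_left (abs_nonneg r) (hs1 n p)
  set P₁ := (pairMat w v v hv : Matrix (Fin N) (Fin N) ℝ) with hP₁
  set P₂ := (pairMat w k v hv : Matrix (Fin N) (Fin N) ℝ)
  set P₃ := (pairMat v k v hv : Matrix (Fin N) (Fin N) ℝ)
  set P₄ := ((1 / 2 : ℝ) • (pairMat k k v hv : Matrix (Fin N) (Fin N) ℝ))
  set L := 2 * C * (2 * C + 2 * (‖w‖ + |r|)) +
    C * (entrySum P₁ + entrySum P₂ + entrySum P₃ + entrySum P₄) with hL
  have hform : ∀ n : ℕ, 1 ≤ n → ∀ p ξ, stressForm (w + W n p) (H + V n p : Sym0 N) ξ ≤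
      (2 * e' / N + L / n) * ‖ξ‖ ^ 2 := fun n hn p ξ => by
    have hn0 : (1 : ℝ) ≤ n := by exact_mod_cast hn
    set a := W n p - (s n p * r) • v with ha
    set G := (f₁ n p - s n p * r) • P₁ + (-f₂ n p) • P₂ + f₃ n p • P₃ + f₄ n p • P₄ with hG
    -- Each value is a point of the admissible segment, with parameter `s n p ∈ [-1, 1]`, plus an
    -- error `(a, G)` of size `O(1 / n)`.
    have h₁ : w + W n p = (w + (s n p * r) • v) + a := by rw [ha]; abel
    have h₂ : ((H + V n p : Sym0 N) : Matrix (Fin N) (Fin N) ℝ) =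
        ((H : Matrix (Fin N) (Fin N) ℝ) + (s n p * r) • shearStress w v) + G := by
      change (H : Matrix (Fin N) (Fin N) ℝ) + (f₁ n p • P₁ - f₂ n p • P₂ + f₃ n p • P₃ + f₄ n p • P₄)
        = (H : Matrix (Fin N) (Fin N) ℝ) + (s n p * r) • P₁ + G
      rw [hG]
      module
    have ha' : ‖a‖ ≤ 2 * C / n := hasym n hn p
    have ha'' : ‖a‖ ≤ 2 * C := ha'.trans (div_le_self (by positivity) hn0)
    have hws : ‖w + (s n p * r) • v‖ ≤ ‖w‖ + |r| :=
      (norm_add_le _ _).trans (add_le_add le_rfl (hsv n p))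
    obtain ⟨-, b₂, b₃, b₄⟩ := (hf n hn).2.2 p
    have hG' : entrySum G ≤
        C / n * (entrySum P₁ + entrySum P₂ + entrySum P₃ + entrySum P₄) := by
      have e₁ := entrySum_nonneg P₁
      have e₂ := entrySum_nonneg P₂
      have e₃ := entrySum_nonneg P₃
      have e₄ := entrySum_nonneg P₄
      calc entrySum G ≤ |f₁ n p - s n p * r| * entrySum P₁ + |-f₂ n p| * entrySum P₂ +
            |f₃ n p| * entrySum P₃ + |f₄ n p| * entrySum P₄ := by
            refine (entrySum_add_smul_le _ _ _).trans (add_le_add ?_ le_rfl)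
            refine (entrySum_add_smul_le _ _ _).trans (add_le_add ?_ le_rfl)
            refine (entrySum_add_smul_le _ _ _).trans (add_le_add ?_ le_rfl)
            rw [entrySum_smul]
        _ ≤ C / n * entrySum P₁ + C / n * entrySum P₂ + C / n * entrySum P₃ +
            C / n * entrySum P₄ := by
            rw [abs_neg]
            gcongr
            exact hsf n hn p
        _ = _ := by ring
    rw [h₁, h₂]
    refine (stressForm_add_le _ _ _ _ ξ).trans ?_
    rw [add_mul (2 * e' / (N : ℝ))]
    refine add_le_add (hdir (s n p) (hs1 n p) ξ) (mul_le_mul_of_nonneg_right ?_ (sq_nonneg _))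
    calc _ ≤ 2 * C / n * (2 * C + 2 * (‖w‖ + |r|)) +
          C / n * (entrySum P₁ + entrySum P₂ + entrySum P₃ + entrySum P₄) := by
          refine add_le_add ?_ hG'
          gcongr
      _ = L / n := by rw [hL]; ring
  have hN' : (0 : ℝ) < N := by exact_mod_cast (by omega : 0 < N)
  -- Dropping the first `n₀` terms makes the error at most half of the gap, so that `(e + e') / 2`
  -- works for the whole sequence; `1 ≤ n₀` avoids division by zero.
  obtain ⟨n₀, hn₀, hn₁⟩ : ∃ n₀ : ℕ, 1 ≤ n₀ ∧ ∀ n : ℕ, n₀ ≤ n → L / n ≤ (e - e') / N := by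
    have := (tendsto_const_div_atTop_nhds_zero_nat L).eventually_le_const
      (div_pos (sub_pos.2 he') hN')
    obtain ⟨m, hm⟩ := eventually_atTop.1 this
    exact ⟨max m 1, le_max_right _ _, fun n hn => hm n ((le_max_left _ _).trans hn)⟩
  refine ⟨fun n => W (n + n₀), fun n => V (n + n₀), (e + e') / 2, 2 * C + |r|, fun n => ?_,
    fun n => ?_, ?_, by linarith, fun n p => ?_, fun n p ξ => ?_, ?_⟩
  · have := (hf (n + n₀) (by omega)).2.1
    exact isTest_shear (isCompact_cutoffSupport N) (cutoffSupport_subset N) w v k hv hk hvk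
      (fun p hp => (this p hp).1) (fun p hp => (this p hp).2.1) (fun p hp => (this p hp).2.2.1)
      (fun p hp => (this p hp).2.2.2)
  · obtain ⟨h₁, h₂, h₃⟩ := (hf (n + n₀) (by omega)).1
    exact solvesLinear_shear w v k hv hk hvk _ _ _ _ h₁ h₂ h₃
  · intro g hg u hu
    exact (tendsto_add_atTop_nat n₀).eventually (hasym.tendstoZeroCWeak hk g hg u hu)
  · have h₁ := hasym (n + n₀) (by omega) p
    have h₂ : 2 * C / ((n + n₀ : ℕ) : ℝ) ≤ 2 * C :=
      div_le_self (by positivity) (by exact_mod_cast (by omega : 1 ≤ n + n₀))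
    have h₃ := hsv (n + n₀) p
    calc ‖W (n + n₀) p‖ ≤ ‖W (n + n₀) p - (s (n + n₀) p * r) • v‖ + ‖(s (n + n₀) p * r) • v‖ :=
          norm_le_norm_sub_add _ _
      _ ≤ _ := add_le_add (h₁.trans h₂) h₃
  · refine (hform (n + n₀) (by omega) p ξ).trans (mul_le_mul_of_nonneg_right ?_ (sq_nonneg _))
    have := hn₁ (n + n₀) (by omega)
    calc _ ≤ 2 * e' / N + (e - e') / N := by linarith
      _ = _ := by ring
  · exact (hasym.tendsto_energy hv hk (by positivity)).comp (tendsto_add_atTop_nat n₀)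

end Deterministic

/-! ### Stability in the parameters and the compact regime -/

section Parameters

variable {N : ℕ}

/-- The oscillations constructed at one parameter serve all nearby parameters. -/
lemma eventually_mem_S (hN : 0 < N) {e e' : ℝ} (he' : e' < e) (w : Vec N) (H : Sym0 N) (B : ℝ) :
    ∀ᶠ q : ℝ × Vec N × Sym0 N in 𝓝 (e, w, H), ∀ (a : Vec N) (G : Sym0 N), ‖a‖ ≤ B →
      (∀ ξ, stressForm (w + a) (H + G : Sym0 N) ξ ≤ 2 * e' / N * ‖ξ‖ ^ 2) →
      (q.2.1 + a, q.2.2 + G) ∈ S N (q.1 - (e - e') / 4) := by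
  set F : ℝ × Vec N × Sym0 N → ℝ := fun q =>
    ‖q.2.1 - w‖ * (‖q.2.1 - w‖ + 2 * (‖w‖ + B)) +
      entrySum ((q.2.2 : Matrix (Fin N) (Fin N) ℝ) - (H : Matrix (Fin N) (Fin N) ℝ)) with hF
  have hFc : Continuous F := by
    have h₀ : Continuous fun q : ℝ × Vec N × Sym0 N => (q.2.2 : Matrix (Fin N) (Fin N) ℝ) :=
      continuous_subtype_val.comp (continuous_snd.comp continuous_snd)
    have h : ∀ i j, Continuous fun q : ℝ × Vec N × Sym0 N =>
        (q.2.2 : Matrix (Fin N) (Fin N) ℝ) i j := fun i j => h₀.matrix_elem i j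
    simp only [hF, entrySum, Matrix.sub_apply]
    refine Continuous.add (by fun_prop) ?_
    exact continuous_finsetSum _ fun i _ => continuous_finsetSum _ fun j _ =>
      ((h i j).sub continuous_const).abs
  have hF0 : F (e, w, H) = 0 := by simp [hF, entrySum]
  have hN' : (0 : ℝ) < N := by exact_mod_cast hN
  have h₁ : ∀ᶠ q in 𝓝 (e, w, H), F q < (e - e') / N := by
    refine hFc.continuousAt.eventually_lt_const ?_
    rw [hF0]; exact div_pos (sub_pos.2 he') hN'
  have h₂ : ∀ᶠ q : ℝ × Vec N × Sym0 N in 𝓝 (e, w, H), e - (e - e') / 4 < q.1 :=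
    continuous_fst.continuousAt.eventually_const_lt (by simp only; linarith)
  filter_upwards [h₁, h₂] with q hq₁ hq₂ a G ha hG
  -- The perturbation of the form costs half of the gap `e - e'`. The drift of `q.1` and the
  -- reserved margin cost a quarter each, the drift strictly less.
  refine mem_S_of_stressForm_le hN (e' := (e + e') / 2) (by linarith) fun ξ => ?_
  have := stressForm_add_le (w + a) (q.2.1 - w) ((H + G : Sym0 N) : Matrix (Fin N) (Fin N) ℝ)
    ((q.2.2 : Matrix (Fin N) (Fin N) ℝ) - (H : Matrix (Fin N) (Fin N) ℝ)) ξ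
  have e₁ : w + a + (q.2.1 - w) = q.2.1 + a := by abel
  have e₂ : ((H + G : Sym0 N) : Matrix (Fin N) (Fin N) ℝ) +
      ((q.2.2 : Matrix (Fin N) (Fin N) ℝ) - (H : Matrix (Fin N) (Fin N) ℝ)) =
      ((q.2.2 + G : Sym0 N) : Matrix (Fin N) (Fin N) ℝ) := by
    push_cast; abel
  rw [e₁, e₂] at this
  refine this.trans ((add_le_add (hG ξ) le_rfl).trans ?_)
  rw [← add_mul]
  refine mul_le_mul_of_nonneg_right ?_ (sq_nonneg _)
  have h₃ : ‖q.2.1 - w‖ * (‖q.2.1 - w‖ + 2 * ‖w + a‖) +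
      entrySum ((q.2.2 : Matrix (Fin N) (Fin N) ℝ) - (H : Matrix (Fin N) (Fin N) ℝ)) ≤ F q := by
    simp only [hF]
    gcongr
    exact (norm_add_le _ _).trans (by linarith)
  calc _ ≤ 2 * e' / N + (e - e') / N := by
        exact add_le_add le_rfl (h₃.trans hq₁.le)
    _ = _ := by ring

lemma amplitude_sq {e : ℝ} (he : 0 < e) (w : Vec N) :
    amplitude N e w ^ 2 = (e - ‖w‖ ^ 2 / 2) ^ 2 / (16 * N ^ 2 * e) := by
  rw [amplitude, div_pow, mul_pow, Real.sq_sqrt he.le]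
  ring

/-- Parameters in the compact regime form a compact set. -/
lemma isCompact_parameters (hN : 0 < N) (M δ : ℝ) (hδ : 0 < δ) :
    IsCompact {q : ℝ × Vec N × Sym0 N | q.1 ≤ M ∧
      ∀ ξ, stressForm q.2.1 q.2.2 ξ ≤ 2 * (q.1 - δ) / N * ‖ξ‖ ^ 2} := by
  have hN' : (0 : ℝ) < N := by exact_mod_cast hN
  have hN1 : (1 : ℝ) ≤ N := by exact_mod_cast hN
  have hS : IsClosed {A : Matrix (Fin N) (Fin N) ℝ | A ∈ Sym0 N} := by
    have h₁ : IsClosed {A : Matrix (Fin N) (Fin N) ℝ | A.transpose = A} :=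
      isClosed_eq continuous_id.matrix_transpose continuous_id
    have h₂ : IsClosed {A : Matrix (Fin N) (Fin N) ℝ | A.trace = 0} :=
      isClosed_eq continuous_id.matrix_trace continuous_const
    exact h₁.inter h₂
  have hbox : IsCompact {A : Matrix (Fin N) (Fin N) ℝ | ∀ i j, A i j ∈ Icc (-(2 * N * M)) (2 * N * M)} := by
    have : IsCompact (Set.pi univ fun _ : Fin N => Set.pi univ fun _ : Fin N =>
        Icc (-(2 * N * M)) (2 * N * M)) :=
      isCompact_univ_pi fun _ => isCompact_univ_pi fun _ => isCompact_Icc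
    refine (congrArg IsCompact ?_).mp this
    ext A
    simp only [mem_univ_pi]
    rfl
  have hcpt : IsCompact (Icc 0 M ×ˢ Metric.closedBall (0 : Vec N) √(2 * M) ×ˢ
      ((Subtype.val : Sym0 N → _) ⁻¹'
        {A : Matrix (Fin N) (Fin N) ℝ | ∀ i j, A i j ∈ Icc (-(2 * N * M)) (2 * N * M)})) :=
    isCompact_Icc.prod ((isCompact_closedBall _ _).prod
      ((IsClosed.isClosedEmbedding_subtypeVal hS).isCompact_preimage hbox))
  refine hcpt.of_isClosed_subset ?_ ?_
  · have hcl : IsClosed {q : ℝ × Vec N × Sym0 N |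
        ∀ ξ, stressForm q.2.1 q.2.2 ξ ≤ 2 * (q.1 - δ) / N * ‖ξ‖ ^ 2} := by
      rw [Set.ofPred_forall]
      refine isClosed_iInter fun ξ => isClosed_le ?_ (by fun_prop)
      have h : Continuous fun q : ℝ × Vec N × Sym0 N => (q.2.2 : Matrix (Fin N) (Fin N) ℝ) :=
        continuous_subtype_val.comp (continuous_snd.comp continuous_snd)
      unfold stressForm
      refine Continuous.sub (by fun_prop) ?_
      exact continuous_const.dotProduct (h.matrix_mulVec continuous_const)
    exact (isClosed_le continuous_fst continuous_const).inter hcl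
  · rintro ⟨e, w, H⟩ ⟨he, hq⟩
    simp only at he hq
    have hw := norm_sq_le_of_stressForm_le hN hq
    -- The margin enters here: `0 ≤ ‖w‖ ^ 2 ≤ 2 (e - δ)` keeps `e` at least `δ`.
    have he0 : 0 ≤ e := by nlinarith [sq_nonneg ‖w‖]
    have hM : 0 ≤ M := he0.trans he
    refine ⟨⟨he0, he⟩, ?_, ?_⟩
    · rw [mem_closedBall_zero_iff]
      exact Real.le_sqrt_of_sq_le (by linarith)
    · have hlow : ∀ ξ : Vec N, -(2 * M * ‖ξ‖ ^ 2) ≤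
          dotProduct ξ.ofLp (Matrix.mulVec (H : Matrix (Fin N) (Fin N) ℝ) ξ.ofLp) := fun ξ => by
        have h₁ := hq ξ
        have h₂ : 2 * (e - δ) / N * ‖ξ‖ ^ 2 ≤ 2 * M * ‖ξ‖ ^ 2 := by
          refine mul_le_mul_of_nonneg_right ?_ (sq_nonneg _)
          refine (div_le_div_of_nonneg_right (by linarith : 2 * (e - δ) ≤ 2 * M) hN'.le).trans ?_
          exact div_le_self (by positivity) hN1
        have h₃ : (0 : ℝ) ≤ ⟪w, ξ⟫ ^ 2 := sq_nonneg _
        unfold stressForm at h₁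
        linarith
      have htr : ∑ i, (H : Matrix (Fin N) (Fin N) ℝ) i i = 0 := H.2.2
      have hsym : ∀ i j, (H : Matrix (Fin N) (Fin N) ℝ) i j = (H : Matrix (Fin N) (Fin N) ℝ) j i :=
        fun i j => H.2.1.apply j i
      set A := (H : Matrix (Fin N) (Fin N) ℝ)
      have hdiag : ∀ i, -(2 * M) ≤ A i i := fun i => by
        have := hlow (EuclideanSpace.single i 1)
        simpa using this
      -- The shifted diagonal entries are nonnegative with sum `2 N M` by zero trace, so each one is
      -- at most the sum.
      have hdiag' : ∀ i, A i i + 2 * M ≤ 2 * N * M := fun i => by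
        have h₁ : A i i + 2 * M ≤ ∑ j, (A j j + 2 * M) :=
          Finset.single_le_sum (f := fun j => A j j + 2 * M)
            (fun j _ => by linarith [hdiag j]) (Finset.mem_univ i)
        rw [Finset.sum_add_distrib, htr] at h₁
        simp at h₁
        linarith
      intro i j
      -- Testing with `e_i ± e_j` bounds the off-diagonal entries by the shifted diagonal ones.
      have key : ∀ σ : ℝ, σ ^ 2 = 1 → i ≠ j → 0 ≤ A i i + A j j + 4 * M + 2 * σ * A i j :=
        fun σ hσ hij => by
          have h₁ := hlow (EuclideanSpace.single i 1 + EuclideanSpace.single j σ)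
          have h₂ : ‖(EuclideanSpace.single i 1 + EuclideanSpace.single j σ : Vec N)‖ ^ 2 = 2 := by
            rw [norm_add_sq_real]
            rw [EuclideanSpace.inner_single_left]
            simp [hij, hσ]
            norm_num
          rw [h₂] at h₁
          simp only [WithLp.ofLp_add, Matrix.mulVec_add, add_dotProduct, dotProduct_add] at h₁
          simp at h₁
          have h₃ : σ * (σ * A j j) = A j j := by rw [← mul_assoc, ← sq, hσ, one_mul]
          rw [← hsym i j, h₃] at h₁
          linarith
      by_cases hij : i = j
      · subst hij
        constructor
        · nlinarith [hdiag i]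
        · linarith [hdiag' i]
      · have h₁ := key 1 (by norm_num) hij
        have h₂ := key (-1) (by norm_num) hij
        have h₃ := hdiag' i
        have h₄ := hdiag' j
        constructor <;> linarith

end Parameters

/-! ### Countable families and measurable selection -/

section Main

variable {N : ℕ}

lemma S_mono {e e' : ℝ} (h : e ≤ e') : S N e ⊆ S N e' := fun _ hp => lt_of_lt_of_le hp h

/-- The constant of the energy estimate. -/
def energyConst (N : ℕ) : ℝ := cutoffEnergy N / (64 * N ^ 2)

lemma energyConst_pos (hN : 0 < N) : 0 < energyConst N := by
  have hN' : (0 : ℝ) < N := by exact_mod_cast hN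
  exact div_pos (cutoffEnergy_pos N) (by positivity)

/-- One sequence of oscillations that serves all parameters in a neighbourhood. -/
lemma exists_local_oscillation (hN : 2 ≤ N) {e : ℝ} (he : 0 < e) {w : Vec N} {H : Sym0 N}
    (h : (w, H) ∈ S N e) :
    ∃ (W : ℕ → C(SpaceTime N, Vec N)) (V : ℕ → C(SpaceTime N, Sym0 N)) (δ : ℝ)
      (O : Set (ℝ × Vec N × Sym0 N)), 0 < δ ∧ IsOpen O ∧ (e, w, H) ∈ O ∧
      (∀ n, IsTestVec (W n) ∧ IsTestMat (V n)) ∧ (∀ n, SolvesLinear (W n) (V n)) ∧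
      TendstoZeroCWeak (fun n => W n) ∧
      (∀ q ∈ O, ∀ n p, (q.2.1 + W n p, q.2.2 + V n p) ∈ S N (q.1 - δ)) ∧
      ∀ q ∈ O, ((energyConst N / q.1 * (q.1 - ‖q.2.1‖ ^ 2 / 2) ^ 2 : ℝ) : EReal) ≤
        liminf (fun n => ((⨍ p in Q N, ‖W n p‖ ^ 2 : ℝ) : EReal)) atTop := by
  have hN0 : 0 < N := by omega
  have hN' : (0 : ℝ) < N := by exact_mod_cast hN0
  obtain ⟨W, V, e', B, hT, hL, hweak, he', hB, hform, hen⟩ := exists_oscillation hN he h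
  obtain ⟨e₁, he₁, hq⟩ := exists_stressForm_le_of_mem_S hN0 h
  have hD : 0 < e - ‖w‖ ^ 2 / 2 := by linarith [norm_sq_le_of_stressForm_le hN0 hq]
  have hlt : ∀ᶠ q : ℝ × Vec N × Sym0 N in 𝓝 (e, w, H),
      energyConst N / q.1 * (q.1 - ‖q.2.1‖ ^ 2 / 2) ^ 2 <
        amplitude N e w ^ 2 * cutoffEnergy N / 2 := by
    have hc : ContinuousAt (fun q : ℝ × Vec N × Sym0 N =>
        energyConst N / q.1 * (q.1 - ‖q.2.1‖ ^ 2 / 2) ^ 2) (e, w, H) := by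
      refine ContinuousAt.mul (ContinuousAt.div continuousAt_const continuousAt_fst he.ne') ?_
      exact Continuous.continuousAt (by fun_prop)
    refine hc.eventually_lt_const ?_
    have hκ := cutoffEnergy_pos N
    rw [amplitude_sq he, energyConst]
    -- `energyConst` is half of what the limit allows (`64` against `16 · 2`), so the inequality is
    -- strict and persists nearby.
    have h₁ : cutoffEnergy N / (64 * N ^ 2) / e * (e - ‖w‖ ^ 2 / 2) ^ 2 =
        (e - ‖w‖ ^ 2 / 2) ^ 2 / (16 * N ^ 2 * e) * cutoffEnergy N / 2 / 2 := by
      field_simp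
      ring
    have h₂ : 0 < (e - ‖w‖ ^ 2 / 2) ^ 2 / (16 * N ^ 2 * e) * cutoffEnergy N / 2 := by positivity
    simp only [h₁]
    linarith
  obtain ⟨O, hO, hOo, hmem⟩ := eventually_nhds_iff.1 ((eventually_mem_S hN0 he' w H B).and hlt)
  refine ⟨W, V, (e - e') / 4, O, by linarith, hOo, hmem, hT, hL, hweak,
    fun q hq n p => (hO q hq).1 _ _ (hB n p) (hform n p), fun q hq => ?_⟩
  have hlim : Tendsto (fun n => ((⨍ p in Q N, ‖W n p‖ ^ 2 : ℝ) : EReal)) atTop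
      (𝓝 ((amplitude N e w ^ 2 * cutoffEnergy N / 2 : ℝ) : EReal)) :=
    (continuous_coe_real_ereal.tendsto _).comp hen
  rw [hlim.liminf_eq]
  exact_mod_cast (hO q hq).2.le

lemma BorelMeasurable.preimage_isOpen {Ω X : Type*} [MeasurableSpace Ω] [TopologicalSpace X]
    {G : Ω → X} (hG : BorelMeasurable G) {O : Set X} (hO : IsOpen O) : MeasurableSet (G ⁻¹' O) :=
  hG (MeasurableSpace.measurableSet_generateFrom hO)

/-- A map factoring through a measurable integer index is Borel measurable. -/
lemma borelMeasurable_comp_index {Ω X : Type*} [MeasurableSpace Ω] [TopologicalSpace X]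
    {idx : Ω → ℕ} (hidx : Measurable idx) (F : ℕ → X) : BorelMeasurable fun ω => F (idx ω) :=
  -- Every subset of `ℕ` is measurable, so `F` and the topology of `X` need no hypothesis.
  fun s _ => hidx (MeasurableSet.of_discrete (s := F ⁻¹' s))

lemma hasCompactRange_comp_index {Ω X : Type*} [MeasurableSpace Ω] [TopologicalSpace X]
    {μ : Measure Ω} {idx : Ω → ℕ} (hidx : Measurable idx) (F : ℕ → X) {m : ℕ}
    (hm : ∀ᵐ ω ∂μ, idx ω ≤ m) : HasCompactRange μ fun ω => F (idx ω) :=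
  ⟨borelMeasurable_comp_index hidx F, F '' Iic m, ((finite_Iic m).image F).isCompact,
    hm.mono fun _ hω => mem_image_of_mem F hω⟩

instance : SecondCountableTopology (Sym0 N) := by
  have : SecondCountableTopology (Matrix (Fin N) (Fin N) ℝ) :=
    inferInstanceAs (SecondCountableTopology (Fin N → Fin N → ℝ))
  exact (Topology.IsInducing.subtypeVal :
    IsInducing (Subtype.val : Sym0 N → Matrix (Fin N) (Fin N) ℝ)).secondCountableTopology

/-- A measurable choice of the index of an open set containing a random variable. -/
lemma exists_measurable_index {Ω X : Type*} [MeasurableSpace Ω] [TopologicalSpace X]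
    {G : Ω → X} (hG : BorelMeasurable G) {O : ℕ → Set X} (hO : ∀ i, IsOpen (O i)) :
    ∃ idx : Ω → ℕ, Measurable idx ∧ ∀ ω, ∀ i, G ω ∈ O i → G ω ∈ O (idx ω) ∧ idx ω ≤ i := by
  classical
  -- The second alternative makes the search total: outside the union of the `O j` it returns `0`.
  have hp : ∀ ω, ∃ i, G ω ∈ O i ∨ G ω ∉ ⋃ j, O j := fun ω => by
    by_cases h : G ω ∈ ⋃ j, O j
    · obtain ⟨i, hi⟩ := mem_iUnion.1 h
      exact ⟨i, Or.inl hi⟩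
    · exact ⟨0, Or.inr h⟩
  refine ⟨fun ω => Nat.find (hp ω), measurable_find hp fun i => ?_, fun ω i hi => ⟨?_, ?_⟩⟩
  · exact (hG.preimage_isOpen (hO i)).union (hG.preimage_isOpen (isOpen_iUnion hO)).compl
  · exact (Nat.find_spec (hp ω)).resolve_right (not_not.2 (mem_iUnion.2 ⟨i, hi⟩))
  · exact Nat.find_min' (hp ω) (Or.inl hi)

/-- Countably many sequences of oscillations serving all admissible parameters. -/
lemma exists_countable_oscillations (hN : 2 ≤ N)
    (hne : ∃ q : ℝ × Vec N × Sym0 N, 0 < q.1 ∧ q.2 ∈ S N q.1) :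
    ∃ (W : ℕ → ℕ → C(SpaceTime N, Vec N)) (V : ℕ → ℕ → C(SpaceTime N, Sym0 N)) (δ : ℕ → ℝ)
      (O : ℕ → Set (ℝ × Vec N × Sym0 N)), (∀ q, 0 < q.1 → q.2 ∈ S N q.1 → ∃ i, q ∈ O i) ∧
      ∀ i, 0 < δ i ∧ IsOpen (O i) ∧
      (∀ n, IsTestVec (W i n) ∧ IsTestMat (V i n)) ∧ (∀ n, SolvesLinear (W i n) (V i n)) ∧
      TendstoZeroCWeak (fun n => W i n) ∧
      (∀ q ∈ O i, ∀ n p, (q.2.1 + W i n p, q.2.2 + V i n p) ∈ S N (q.1 - δ i)) ∧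
      ∀ q ∈ O i, ((energyConst N / q.1 * (q.1 - ‖q.2.1‖ ^ 2 / 2) ^ 2 : ℝ) : EReal) ≤
        liminf (fun n => ((⨍ p in Q N, ‖W i n p‖ ^ 2 : ℝ) : EReal)) atTop := by
  let U := {q : ℝ × Vec N × Sym0 N // 0 < q.1 ∧ q.2 ∈ S N q.1}
  choose W V δ O hδ hO hmem hrest using
    fun q : U => exists_local_oscillation hN (e := q.1.1) q.2.1 (w := q.1.2.1) (H := q.1.2.2) q.2.2
  have : SecondCountableTopology U := (Topology.IsInducing.subtypeVal :
    IsInducing (Subtype.val : U → ℝ × Vec N × Sym0 N)).secondCountableTopology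
  -- Lindelöf property of the set of admissible parameters.
  obtain ⟨t, htc, ht⟩ := TopologicalSpace.countable_cover_nhds (α := U)
    (f := fun q => Subtype.val ⁻¹' O q)
    fun q => ((hO q).preimage continuous_subtype_val).mem_nhds (hmem q)
  obtain ⟨q₀, hq₀⟩ := hne
  -- Nonemptiness, which comes from `hne`, allows the countable subcover to be enumerated by all of
  -- `ℕ`.
  have htn : t.Nonempty := by
    have : (⟨q₀, hq₀⟩ : U) ∈ ⋃ x ∈ t, Subtype.val ⁻¹' O x := ht ▸ mem_univ _
    simp only [mem_iUnion] at this
    obtain ⟨x, hx, -⟩ := this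
    exact ⟨x, hx⟩
  obtain ⟨g, rfl⟩ := htc.exists_eq_range htn
  refine ⟨fun i => W (g i), fun i => V (g i), fun i => δ (g i), fun i => O (g i),
    fun q hq hq' => ?_, fun i => ⟨hδ _, hO _, hrest _⟩⟩
  have : (⟨q, hq, hq'⟩ : U) ∈ ⋃ x ∈ range g, Subtype.val ⁻¹' O x := ht ▸ mem_univ _
  simp only [mem_iUnion, mem_range] at this
  obtain ⟨_, ⟨i, rfl⟩, hi⟩ := this
  exact ⟨i, hi⟩

end Main

end

end OscillatoryLemma

/-! ### Assembly for random data -/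

theorem lemma4p2 (N : ℕ) (hN : 2 ≤ N) :
    ∃ c : ℝ, 0 < c ∧
      ∀ (Ω : Type*) [MeasurableSpace Ω] (μ : Measure Ω) [IsProbabilityMeasure μ] [μ.IsComplete]
        (e : Ω → ℝ) (w : Ω → OscillatoryLemma.Vec N) (H : Ω → OscillatoryLemma.Sym0 N),
        (∀ ω, 0 < e ω) →
        OscillatoryLemma.BorelMeasurable (fun ω => (e ω, w ω, H ω)) →
        (∀ᵐ ω ∂μ, (w ω, H ω) ∈ OscillatoryLemma.S N (e ω)) →
        ∃ (W : ℕ → Ω → C(OscillatoryLemma.SpaceTime N, OscillatoryLemma.Vec N))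
          (V : ℕ → Ω → C(OscillatoryLemma.SpaceTime N, OscillatoryLemma.Sym0 N)),
          (∀ n, ∀ᵐ ω ∂μ,
            OscillatoryLemma.IsTestVec (W n ω) ∧ OscillatoryLemma.IsTestMat (V n ω)) ∧
          (∀ n, ∀ t ∈ Icc (0 : ℝ) 1,
            OscillatoryLemma.BorelMeasurable
              (fun ω => OscillatoryLemma.slice t (W n ω) (V n ω))) ∧
          (∀ n, ∀ᵐ ω ∂μ, OscillatoryLemma.SolvesLinear (W n ω) (V n ω)) ∧
          (∀ᵐ ω ∂μ, OscillatoryLemma.TendstoZeroCWeak (fun n => W n ω)) ∧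
          (∀ n, ∀ᵐ ω ∂μ, ∀ p ∈ OscillatoryLemma.Q N,
            (w ω + W n ω p, H ω + V n ω p) ∈ OscillatoryLemma.S N (e ω)) ∧
          (∀ᵐ ω ∂μ,
            ((c / e ω * (e ω - ‖w ω‖ ^ 2 / 2) ^ 2 : ℝ) : EReal) ≤
              liminf (fun n => ((⨍ p in OscillatoryLemma.Q N, ‖W n ω p‖ ^ 2 : ℝ) : EReal))
                atTop) ∧
          ((∃ eM : ℝ, ∀ᵐ ω ∂μ, e ω ≤ eM) →
            (∃ δ : ℝ, 0 < δ ∧ ∀ᵐ ω ∂μ, (w ω, H ω) ∈ OscillatoryLemma.S N (e ω - δ)) →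
            (∀ n,
              OscillatoryLemma.HasCompactRange μ
                (fun ω => (W n ω).restrict (closure (OscillatoryLemma.Q N))) ∧
              OscillatoryLemma.HasCompactRange μ
                (fun ω => (V n ω).restrict (closure (OscillatoryLemma.Q N)))) ∧
            ∃ δ : ℕ → ℝ, (∀ n, 0 < δ n) ∧
              ∀ n, ∀ᵐ ω ∂μ, ∀ p ∈ OscillatoryLemma.Q N,
                (w ω + W n ω p, H ω + V n ω p) ∈ OscillatoryLemma.S N (e ω - δ n)) := by
  have hN0 : 0 < N := by omega
  refine ⟨OscillatoryLemma.energyConst N, OscillatoryLemma.energyConst_pos hN0, ?_⟩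
  intro Ω _ μ _ _ e w H he hmeas hS
  obtain ⟨ω₀, hω₀⟩ := hS.exists
  obtain ⟨W, V, δ, O, hcover, hprop⟩ :=
    OscillatoryLemma.exists_countable_oscillations hN ⟨(e ω₀, w ω₀, H ω₀), he ω₀, hω₀⟩
  obtain ⟨idx, hidx, hidx'⟩ :=
    OscillatoryLemma.exists_measurable_index hmeas fun i => (hprop i).2.1
  have hmem : ∀ᵐ ω ∂μ, (e ω, w ω, H ω) ∈ O (idx ω) := hS.mono fun ω hω => by
    obtain ⟨i, hi⟩ := hcover (e ω, w ω, H ω) (he ω) hω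
    exact (hidx' ω i hi).1
  refine ⟨fun n ω => W (idx ω) n, fun n ω => V (idx ω) n,
    fun n => ae_of_all _ fun ω => (hprop _).2.2.1 n, fun n t _ => ?_,
    fun n => ae_of_all _ fun ω => (hprop _).2.2.2.1 n,
    ae_of_all _ fun ω => (hprop _).2.2.2.2.1, fun n => hmem.mono fun ω hω p _ => ?_,
    hmem.mono fun ω hω => (hprop _).2.2.2.2.2.2 _ hω, ?_⟩
  · exact OscillatoryLemma.borelMeasurable_comp_index hidx
      fun i => OscillatoryLemma.slice t (W i n) (V i n)
  · exact OscillatoryLemma.S_mono (by linarith [(hprop (idx ω)).1])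
      ((hprop _).2.2.2.2.2.1 _ hω n p)
  · rintro ⟨M, hM⟩ ⟨d, hd, hSd⟩
    have hK := OscillatoryLemma.isCompact_parameters hN0 M d hd
    -- The margin `d` places every point of the compact set among the admissible parameters, where
    -- the `O i` form a cover.
    obtain ⟨F, hF⟩ := hK.elim_finite_subcover O (fun i => (hprop i).2.1) fun q hq => by
      have hw := OscillatoryLemma.norm_sq_le_of_stressForm_le hN0 hq.2
      obtain ⟨i, hi⟩ := hcover q (by nlinarith [sq_nonneg ‖q.2.1‖])
        (OscillatoryLemma.mem_S_of_stressForm_le hN0 (by linarith) hq.2)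
      exact mem_iUnion.2 ⟨i, hi⟩
    -- `idx ω` is the least admissible index, so any member of `F` that works bounds it, although
    -- `idx ω` need not lie in `F`.
    have hle : ∀ᵐ ω ∂μ, idx ω ≤ F.sup id := by
      filter_upwards [hM, hSd] with ω hω₁ hω₂
      obtain ⟨e', he', hq⟩ := OscillatoryLemma.exists_stressForm_le_of_mem_S hN0 hω₂
      have hmemK := hF (show (e ω, w ω, H ω) ∈ _ from ⟨hω₁, fun ξ => (hq ξ).trans (by gcongr)⟩)
      simp only [mem_iUnion] at hmemK
      obtain ⟨i, hiF, hi⟩ := hmemK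
      exact (hidx' ω i hi).2.trans (Finset.le_sup (f := id) hiF)
    refine ⟨fun n => ⟨?_, ?_⟩, ?_⟩
    · exact OscillatoryLemma.hasCompactRange_comp_index hidx
        (fun i => (W i n).restrict (closure (OscillatoryLemma.Q N))) hle
    · exact OscillatoryLemma.hasCompactRange_comp_index hidx
        (fun i => (V i n).restrict (closure (OscillatoryLemma.Q N))) hle
    · obtain ⟨j, -, hj⟩ := (Finset.range (F.sup id + 1)).exists_min_image δ ⟨0, by simp⟩
      refine ⟨fun _ => δ j, fun _ => (hprop j).1, fun n => ?_⟩
      filter_upwards [hmem, hle] with ω hω hω' p _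
      exact OscillatoryLemma.S_mono
        (by linarith [hj (idx ω) (Finset.mem_range.2 (Nat.lt_succ_of_le hω'))])
        ((hprop _).2.2.2.2.2.1 _ hω n p)
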